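/- A *dg category* $\mathcal B$ is a category enriched in (homologically graded) chain complexes of abelian groups; its *homology category* $\mathbf H(\mathcal B)$ has the same objects and morphisms $H_0(\mathcal B(X,Y))$. A mapping cone of a closed morphism (a $0$-cycle) $f:X\to Y$ is an object $C$ with a universal pair $i\in\mathcal B(Y,C)_0$, $u\in\mathcal B(X,C)_1$, $di=0$, $du=if$, i.e. such that $\varphi\mapsto(\varphi i,(-1)^{|\varphi|}\varphi u)$ is a bijection $\mathcal B(C,Z)_k\cong\mathcal B(Y,Z)_k\oplus\mathcal B(X,Z)_{k+1}$ for all $Z$, $k$. The dg category is *pretriangulated* if it has a zero object, all shifts $X[a]$ ($a\in\mathbb Z$; $X[a]$ represents $\mathcal B(X,-)[-a]$) and all mapping cones. Then $\mathbf H(\mathcal B)$ carries the shift functor $X\mapsto X[1]$, and its distinguished triangles are those isomorphic to the image of some $X\xrightarrow{f}Y\xrightarrow{i}C\xrightarrow{\bar p}X[1]$ with $C$ a mapping cone of $f$, where $\bar p$ corresponds to the cycle $p\in\mathcal B(C,X)_{-1}$ with $pi=0$, $-pu=1_X$. A triangulated category is *algebraic* if it is equivalent, as a triangulated category, to $\mathbf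 H(\mathcal B)$ for some pretriangulated dg category $\mathcal B$. Let $\mathcal T$ be a triangulated category and $n\ge 1$. A *mod-$n$ reduction* of $\mathcal T$ is a triangulated category $\mathcal T/n$ with an exact functor $\rho_*:\mathcal T\to\mathcal T/n$ that has a right adjoint $\rho^*$ and such that for every object $X$ there is a distinguished triangle $X\xrightarrow{n}X\xrightarrow{\eta_X}\rho^*\rho_*X\to\Sigma X$ with $\eta$ the unit of the adjunction. Every object of $\mathcal T$ has *$n$-order* $\ge 0$; for $k\ge1$ an object $X$ has $n$-order $\ge k$ if for every object $K$, every cone $\pi:K\to K/n$ of $n\cdot 1_K$ and every $f:K\to X$ there is $\bar f:K/n\to X$ with $\bar f\pi=f$ such that some cone of $\bar f$ has $n$-order $\ge k-1$. The $n$-order of $X$ is the largest such $k\in\mathbb N\cup\{\infty\}$, and the $n$-order of $\mathcal T$ is that of a zero object. **Theorem.** Let $\mathcal T$ be an algebraic triangulated category and $n\ge1$. Then $\mathcal T$ has a mod-$n$ reduction, and $\mathcal T$ has infinite $n$-order. Moreover, for $\mathcal T=\mathbf H(\mathcal B)$ with $\mathcal B$ a pretriangulated dg category, a mod-$n$ reduction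 can be described as follows. Let $\mathbb Z[e]\otimes\mathcal B$ be the dg category with the objects of $\mathcal B$ and morphism complexes $\mathbb Z[e]\otimes\mathcal B(X,Y)$, where $\mathbb Z[e]$ is the exterior algebra on a class $e$ of degree $1$ with $de=n$, and composition $(1\otimes\varphi+e\otimes\psi)(1\otimes\varphi'+e\otimes\psi')=1\otimes\varphi\varphi'+e\otimes(\psi\varphi'+(-1)^{|\varphi|}\varphi\psi')$. There is a pretriangulated envelope $\iota:\mathbb Z[e]\otimes\mathcal B\to\mathcal B/n$ (a fully faithful dg functor to a pretriangulated dg category, all of whose objects are obtained from zero objects and the image of $\iota$ by finitely many shifts and mapping cones) and a dg functor $t:\mathcal B/n\to\mathcal B$ such that: * $\mathbf H(\mathcal B)$ and $\mathbf H(\mathcal B/n)$, with the shifts and distinguished triangles above, are triangulated categories; * for every $X$ in $\mathcal B$, $t(\iota X)$ is a mapping cone of $n\cdot1_X$ with universal pair $(\eta_X,g_X)$, and for $\theta=1\otimes\varphi+e\otimes\psi$ of degree $k$ from $X$ to $Y$ one has $t(\iota\theta)\,\eta_X=\eta_Y\varphi+g_Y\psi$ and $(-1)^k\,t(\iota\theta)\,g_X=g_Y\varphi$;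 * the functor $\rho_*:\mathbf H(\mathcal B)\to\mathbf H(\mathcal B/n)$ induced by $\varphi\mapsto\iota(1\otimes\varphi)$, with right adjoint $\rho^*=\mathbf H(t)$ and with the class of $\eta_X$ as adjunction unit at $X$, is a mod-$n$ reduction of $\mathbf H(\mathcal B)$. -/

import Mathlib

open CategoryTheory CategoryTheory.Limits CategoryTheory.Pretriangulated

universe w₁ w₂ v' u' v u

/-- A differential graded category: a category enriched in (homologically graded, unbounded) chain
complexes of abelian groups. `Hom X Y k` is the group of morphisms of degree `k`, the differential
lowers the degree by one, and `comp h φ ψ` is the composite `φ · ψ` (first `ψ`, then `φ`). The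
index equations are arguments, so that no transport along equalities of degrees is needed. -/
class DGCategory (B : Type u) where
  Hom : B → B → ℤ → Type v
  [addCommGroup : ∀ (X Y : B) (k : ℤ), AddCommGroup (Hom X Y k)]
  d : ∀ {X Y : B} (i j : ℤ), j + 1 = i → (Hom X Y i →+ Hom X Y j)
  comp : ∀ {X Y Z : B} {i j k : ℤ}, i + j = k → (Hom Y Z i →+ Hom X Y j →+ Hom X Z k)
  one : ∀ (X : B), Hom X X 0
  d_d : ∀ {X Y : B} (i j k : ℤ) (hij : j + 1 = i) (hjk : k + 1 = j) (φ : Hom X Y i),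
    d j k hjk (d i j hij φ) = 0
  d_one : ∀ (X : B), d 0 (-1) (by lia) (one X) = 0
  one_comp : ∀ {X Y : B} {k : ℤ} (h : 0 + k = k) (φ : Hom X Y k), comp h (one Y) φ = φ
  comp_one : ∀ {X Y : B} {k : ℤ} (h : k + 0 = k) (φ : Hom X Y k), comp h φ (one X) = φ
  assoc : ∀ {W X Y Z : B} {i j k ij jk ijk : ℤ} (hij : i + j = ij) (hjk : j + k = jk)
    (h : ij + k = ijk) (h' : i + jk = ijk) (φ : Hom Y Z i) (ψ : Hom X Y j) (χ : Hom W X k),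
    comp h (comp hij φ ψ) χ = comp h' φ (comp hjk ψ χ)
  leibniz : ∀ {X Y Z : B} {i i' j j' k k' : ℤ} (hi : i' + 1 = i) (hj : j' + 1 = j)
    (hk : k' + 1 = k) (h : i + j = k) (h₁ : i' + j = k') (h₂ : i + j' = k')
    (φ : Hom Y Z i) (ψ : Hom X Y j),
    d k k' hk (comp h φ ψ) =
      comp h₁ (d i i' hi φ) ψ + i.negOnePow • comp h₂ φ (d j j' hj ψ)

namespace DGCategory

attribute [reducible, instance] DGCategory.addCommGroup

section Basic

variable {B : Type u} [DGCategory.{v} B]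

/-- A closed morphism is a cycle of degree `0`. -/
def IsClosed {X Y : B} (f : Hom X Y 0) : Prop := d 0 (-1) (by lia) f = 0

/-- The pair `(Y, s)` with `s ∈ B(X, Y)_a` a cycle represents the module `B(X, -)[-a]`, that is,
for every `Z` and every degree the map `φ ↦ φ · s` is bijective. (In the module `B(X, -)[-a]` the
map is `φ ↦ φ · (s[-a]) = ± (φ s)[-a]`; the sign depends on the degree of `φ` only.) -/
structure IsShift (X : B) (a : ℤ) (Y : B) (s : Hom X Y a) : Prop where
  d_eq : d a (a - 1) (by lia) s = 0
  bijective : ∀ (Z : B) (k l : ℤ) (h : k + a = l),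
    Function.Bijective (fun φ : Hom Y Z k => (comp h φ s : Hom X Z l))

/-- The object `C` together with the universal `0`-cycle `(i, u) ∈ B(Y, C)_0 ⊕ B(X, C)_1` is a
mapping cone of the closed morphism `f : X ⟶ Y`, that is, it represents the module
`M(Z)_k = B(Y, Z)_k ⊕ B(X, Z)_{k+1}`, `d (a, b) = (d a, a f - d b)`,
`φ · (a, b) = (φ a, (-1)^{|φ|} φ b)`. The first two fields say that `(i, u)` is a cycle. -/
structure IsCone {X Y : B} (f : Hom X Y 0) (C : B) (i : Hom Y C 0) (u : Hom X C 1) : Prop where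
  d_inl : d 0 (-1) (by lia) i = 0
  d_inr : d 1 0 (by lia) u = comp (by lia) i f
  bijective : ∀ (Z : B) (k l : ℤ) (h : k + 1 = l),
    Function.Bijective (fun φ : Hom C Z k =>
      ((comp (by lia) φ i, k.negOnePow • comp h φ u) : Hom Y Z k × Hom X Z l))

/-- For a mapping cone `C` of `f : X ⟶ Y` with universal `0`-cycle `(i, u)`, there is a unique
`p ∈ B(C, X)_{-1}` with `p · (i, u) = (0, 1_X)`; it is a cycle. -/
lemma IsCone.existsUnique_p {X Y C : B} {f : Hom X Y 0} {i : Hom Y C 0} {u : Hom X C 1}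
    (h : IsCone f C i u) : ∃! p : Hom C X (-1),
      comp (by lia) p i = (0 : Hom Y X (-1)) ∧ -comp (by lia) p u = one X := by
  obtain ⟨p, hp, hp'⟩ := (h.bijective X (-1) 0 (by lia)).existsUnique (0, one X)
  simp only [Prod.mk.injEq, Int.negOnePow_neg, Int.negOnePow_one, Units.neg_smul, one_smul]
    at hp hp'
  exact ⟨p, hp, hp'⟩

/-- A zero object of a dg category: all morphism complexes from and to it vanish. -/
def IsZeroObj (Z : B) : Prop :=
  ∀ (X : B) (k : ℤ), Subsingleton (Hom X Z k) ∧ Subsingleton (Hom Z X k)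

end Basic

/-- A dg category is pretriangulated if it has a zero object and is closed under shifts and
cones. -/
class IsPretriangulated (B : Type u) [DGCategory.{v} B] : Prop where
  exists_zero : ∃ Z : B, IsZeroObj Z
  exists_shift : ∀ (X : B) (a : ℤ), ∃ (Y : B) (s : Hom X Y a), IsShift X a Y s
  exists_cone : ∀ {X Y : B} (f : Hom X Y 0), IsClosed f →
    ∃ (C : B) (i : Hom Y C 0) (u : Hom X C 1), IsCone f C i u

section CycleCategory

variable (B : Type u) [DGCategory.{v} B]

/-- The cycle category `Z(B)`: same objects, the morphisms are the closed morphisms. -/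
structure ZCat where
  as : B

variable {B}

/-- The group of closed morphisms. -/
def cycles (X Y : B) : AddSubgroup (Hom X Y 0) := (d 0 (-1) (by lia)).ker

lemma mem_cycles {X Y : B} {f : Hom X Y 0} :
    f ∈ cycles X Y ↔ d 0 (-1) (by lia) f = 0 := AddMonoidHom.mem_ker

lemma cycles_comp {X Y Z : B} {f : Hom Y Z 0} {g : Hom X Y 0} (hf : f ∈ cycles Y Z)
    (hg : g ∈ cycles X Y) : comp (by lia) f g ∈ cycles X Z := by
  rw [mem_cycles] at *
  rw [leibniz (i' := -1) (j' := -1) (by lia) (by lia) (by lia) (by lia) (by lia) (by lia),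
    hf, hg]
  simp

instance : Category.{v} (ZCat B) where
  Hom X Y := cycles X.as Y.as
  id X := ⟨one X.as, mem_cycles.2 (d_one _)⟩
  comp f g := ⟨comp (by lia) g.1 f.1, cycles_comp g.2 f.2⟩
  id_comp f := Subtype.ext (comp_one _ _)
  comp_id f := Subtype.ext (one_comp _ _)
  assoc f g h := Subtype.ext (assoc _ _ _ _ _ _ _).symm

/-- A closed morphism of `B`, as a morphism of the cycle category. -/
def ZCat.homMk {X Y : B} (f : Hom X Y 0) (hf : IsClosed f) :
    (ZCat.mk X ⟶ ZCat.mk Y) := ⟨f, hf⟩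

lemma ZCat.hom_ext {X Y : ZCat B} {f g : X ⟶ Y} (h : f.1 = g.1) : f = g := Subtype.ext h

@[simp] lemma ZCat.id_val (X : ZCat B) : (𝟙 X : X ⟶ X).1 = one X.as := rfl

@[simp] lemma ZCat.comp_val {X Y Z : ZCat B} (f : X ⟶ Y) (g : Y ⟶ Z) :
    (f ≫ g).1 = comp (by lia) g.1 f.1 := rfl

instance : Preadditive (ZCat B) where
  homGroup X Y := inferInstanceAs (AddCommGroup (cycles X.as Y.as))
  add_comp X Y Z f f' g := Subtype.ext (map_add (comp _ g.1) f.1 f'.1)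
  comp_add X Y Z f g g' := Subtype.ext (by
    change comp _ (g.1 + g'.1) f.1 = comp _ g.1 f.1 + comp _ g'.1 f.1
    simp)

@[simp] lemma ZCat.add_val {X Y : ZCat B} (f g : X ⟶ Y) : (f + g).1 = f.1 + g.1 := rfl

@[simp] lemma ZCat.sub_val {X Y : ZCat B} (f g : X ⟶ Y) : (f - g).1 = f.1 - g.1 := rfl

lemma ZCat.d_val {X Y : ZCat B} (f : X ⟶ Y) : d 0 (-1) (by lia) f.1 = 0 := mem_cycles.1 f.2

variable (B) in
/-- Two closed morphisms are homologous if they differ by a boundary. -/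
def homologous : HomRel (ZCat B) := fun X Y f g =>
  ∃ h : Hom X.as Y.as 1, f.1 - g.1 = d 1 0 (by lia) h

instance : Congruence (homologous B) where
  equivalence :=
    { refl := fun f => ⟨0, by simp⟩
      symm := by
        rintro f g ⟨h, hh⟩
        exact ⟨-h, by rw [map_neg, ← hh, neg_sub]⟩
      trans := by
        rintro f g k ⟨h, hh⟩ ⟨h', hh'⟩
        exact ⟨h + h', by rw [map_add, ← hh, ← hh', sub_add_sub_cancel]⟩ }
  comp_left := by
    rintro X Y Z f g g' ⟨h, hh⟩
    refine ⟨comp (by lia) h f.1, ?_⟩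
    rw [leibniz (i' := 0) (j' := -1) (by lia) (by lia) (by lia) (by lia) (by lia) (by lia),
      ZCat.d_val f, ← hh]
    simp
  comp_right := by
    rintro X Y Z f f' g ⟨h, hh⟩
    refine ⟨comp (by lia) g.1 h, ?_⟩
    rw [leibniz (i' := -1) (j' := 0) (by lia) (by lia) (by lia) (by lia) (by lia) (by lia),
      ZCat.d_val g, ← hh]
    simp

variable (B) in
/-- The homology category `H(B)`, with `H(B)(X, Y) = H_0(B(X, Y))`. -/
abbrev HCat := Quotient (homologous B)

variable (B) in
/-- The canonical functor from the cycle category to the homology category. -/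
abbrev toH : ZCat B ⥤ HCat B := Quotient.functor (homologous B)

variable (B) in
lemma homologous_add ⦃X Y : ZCat B⦄ (f₁ f₂ g₁ g₂ : X ⟶ Y) (hf : homologous B f₁ f₂)
    (hg : homologous B g₁ g₂) : homologous B (f₁ + g₁) (f₂ + g₂) := by
  obtain ⟨h, hh⟩ := hf
  obtain ⟨h', hh'⟩ := hg
  refine ⟨h + h', ?_⟩
  rw [map_add, ← hh, ← hh']
  simp only [ZCat.add_val]
  abel

noncomputable instance : Preadditive (HCat B) :=
  Quotient.preadditive (homologous B) (homologous_add B)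

instance : (toH B).Additive := Quotient.functor_additive (homologous B) (homologous_add B)

/-- An object of `B`, as an object of the homology category. -/
def HCat.of (X : B) : HCat B := (toH B).obj (ZCat.mk X)

/-- The homology class of a closed morphism. -/
def HCat.homMk {X Y : B} (f : Hom X Y 0) (hf : IsClosed f) : HCat.of X ⟶ HCat.of Y :=
  (toH B).map (ZCat.homMk f hf)

instance [IsPretriangulated B] : HasZeroObject (HCat B) := by
  obtain ⟨Z, hZ⟩ := IsPretriangulated.exists_zero (B := B)
  refine ⟨(toH B).obj ⟨Z⟩, ?_⟩
  refine (IsZero.iff_id_eq_zero _).2 ?_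
  rw [← (toH B).map_id, ← (toH B).map_zero]
  congr 1
  exact ZCat.hom_ext ((hZ Z 0).1.elim _ _)

end CycleCategory

section Shift

variable {B : Type u} [DGCategory.{v} B]

lemma assoc' {W X Y Z : B} {i j k jk ijk : ℤ} (hjk : j + k = jk) (h' : i + jk = ijk)
    (φ : Hom Y Z i) (ψ : Hom X Y j) (χ : Hom W X k) :
    comp h' φ (comp hjk ψ χ) = comp (by lia) (comp rfl φ ψ) χ :=
  (assoc _ _ _ _ _ _ _).symm

lemma IsShift.cancel {X Y Z : B} {a k l : ℤ} {s : Hom X Y a} (hs : IsShift X a Y s)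
    (h : k + a = l) {φ ψ : Hom Y Z k} (e : comp h φ s = comp h ψ s) : φ = ψ :=
  (hs.bijective Z k l h).1 e

lemma d_comp_eq_zero {X Y Z : B} {i j k k' : ℤ} (h : i + j = k) (hk : k' + 1 = k)
    (φ : Hom Y Z i) (ψ : Hom X Y j) (hφ : d i (i - 1) (by lia) φ = 0)
    (hψ : d j (j - 1) (by lia) ψ = 0) : d k k' hk (comp h φ ψ) = 0 := by
  rw [leibniz (i' := i - 1) (j' := j - 1) (by lia) (by lia) (by lia) (by lia) (by lia) (by lia),
    hφ, hψ]
  simp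

lemma map_zsmul_units {G G' : Type*} [AddCommGroup G] [AddCommGroup G'] (f : G →+ G') (ε : ℤˣ)
    (x : G) : f (ε • x) = ε • f x := by
  rw [Units.smul_def, Units.smul_def, map_zsmul]

lemma units_smul_apply {G G' : Type*} [AddCommGroup G] [AddCommGroup G'] (ε : ℤˣ) (f : G →+ G')
    (x : G) : (ε • f) x = ε • f x := rfl

lemma nsmul_units_comm {G : Type*} [AddCommGroup G] (n : ℕ) (ε : ℤˣ) (x : G) :
    n • ε • x = ε • n • x := by
  rw [Units.smul_def, Units.smul_def, smul_comm]

lemma d_comp_cycle {X Y Z : B} {i i' j k k' : ℤ} {h : i + j = k} {hi : i' + 1 = i}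
    {hk : k' + 1 = k} (φ : Hom Y Z i) (ψ : Hom X Y j) (hψ : d j (j - 1) (by lia) ψ = 0) :
    d k k' hk (comp h φ ψ) = comp (by lia) (d i i' hi φ) ψ := by
  rw [leibniz (i' := i') (j' := j - 1) (by lia) (by lia) (by lia) (by lia) (by lia) (by lia), hψ]
  simp

lemma d_cycle_comp {X Y Z : B} {i j j' k k' : ℤ} {h : i + j = k} {hj : j' + 1 = j}
    {h' : i + j' = k'} {hk : k' + 1 = k} (φ : Hom Y Z i) (ψ : Hom X Y j)
    (hφ : d i (i - 1) (by lia) φ = 0) :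
    d k k' hk (comp h φ ψ) = i.negOnePow • comp h' φ (d j j' hj ψ) := by
  rw [leibniz (i' := i - 1) (j' := j') (by lia) (by lia) (by lia) (by lia) (by lia) (by lia), hφ]
  simp

/-- If `(Y, s)` represents `B(X, -)[-a]`, then every `t ∈ B(X, Z)_a` corresponds to a unique
morphism `Y ⟶ Z` of degree `0`. -/
noncomputable def IsShift.desc {X Y Z : B} {a : ℤ} {s : Hom X Y a} (hs : IsShift X a Y s)
    (t : Hom X Z a) : Hom Y Z 0 :=
  ((hs.bijective Z 0 a (zero_add a)).2 t).choose

@[simp] lemma IsShift.desc_comp {X Y Z : B} {a : ℤ} {s : Hom X Y a} (hs : IsShift X a Y s)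
    (t : Hom X Z a) : comp (zero_add a) (hs.desc t) s = t :=
  ((hs.bijective Z 0 a (zero_add a)).2 t).choose_spec

lemma IsShift.desc_mem {X Y Z : B} {a : ℤ} {s : Hom X Y a} (hs : IsShift X a Y s)
    (t : Hom X Z a) (ht : d a (a - 1) (by lia) t = 0) : hs.desc t ∈ cycles Y Z := by
  rw [mem_cycles]
  apply hs.cancel (l := a - 1) (by lia)
  have := leibniz (i := 0) (i' := -1) (j := a) (j' := a - 1) (k := a) (k' := a - 1)
    (by lia) (by lia) (by lia) (by lia) (by lia) (by lia) (hs.desc t) s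
  rw [hs.desc_comp, ht, hs.d_eq] at this
  simpa using this.symm

/-- `IsShift.desc`, as a morphism of the cycle category. -/
noncomputable def IsShift.zDesc {X Y Z : B} {a : ℤ} {s : Hom X Y a} (hs : IsShift X a Y s)
    (t : Hom X Z a) (ht : d a (a - 1) (by lia) t = 0) : ZCat.mk Y ⟶ ZCat.mk Z :=
  ⟨hs.desc t, hs.desc_mem t ht⟩

@[simp] lemma IsShift.zDesc_comp {X Y Z : B} {a : ℤ} {s : Hom X Y a} (hs : IsShift X a Y s)
    (t : Hom X Z a) (ht : d a (a - 1) (by lia) t = 0) :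
    comp (zero_add a) (hs.zDesc t ht).1 s = t :=
  hs.desc_comp t

lemma IsShift.zhom_ext {X Y : B} {a : ℤ} {s : Hom X Y a} (hs : IsShift X a Y s) {Z : ZCat B}
    {f g : ZCat.mk Y ⟶ Z} (h : comp (zero_add a) f.1 s = comp (zero_add a) g.1 s) : f = g :=
  ZCat.hom_ext (hs.cancel (zero_add a) h)

/-- Composition in the cycle category, evaluated at an arbitrary element. -/
lemma ZCat.comp_val_comp {X Y Z : ZCat B} (f : X ⟶ Y) (g : Y ⟶ Z) {W : B} {a : ℤ}
    (s : Hom W X.as a) :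
    comp (zero_add a) (f ≫ g).1 s = comp (zero_add a) g.1 (comp (zero_add a) f.1 s) :=
  assoc _ _ _ _ _ _ _

/-- Two objects that represent the same shifted module are canonically isomorphic. -/
noncomputable def IsShift.iso {X Y Z : B} {a : ℤ} {s : Hom X Y a} {t : Hom X Z a}
    (hs : IsShift X a Y s) (ht : IsShift X a Z t) : ZCat.mk Y ≅ ZCat.mk Z where
  hom := hs.zDesc t ht.d_eq
  inv := ht.zDesc s hs.d_eq
  hom_inv_id := hs.zhom_ext (by
    rw [ZCat.comp_val_comp, hs.zDesc_comp, ht.zDesc_comp]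
    exact (one_comp _ _).symm)
  inv_hom_id := ht.zhom_ext (by
    rw [ZCat.comp_val_comp, ht.zDesc_comp, hs.zDesc_comp]
    exact (one_comp _ _).symm)

@[simp] lemma IsShift.iso_hom_comp {X Y Z : B} {a : ℤ} {s : Hom X Y a} {t : Hom X Z a}
    (hs : IsShift X a Y s) (ht : IsShift X a Z t) :
    comp (zero_add a) (hs.iso ht).hom.1 s = t :=
  hs.desc_comp t

@[simp] lemma IsShift.iso_inv_comp {X Y Z : B} {a : ℤ} {s : Hom X Y a} {t : Hom X Z a}
    (hs : IsShift X a Y s) (ht : IsShift X a Z t) :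
    comp (zero_add a) (hs.iso ht).inv.1 t = s :=
  ht.desc_comp s

lemma IsShift.iso_naturality {X Y Z X' Y' Z' : B} {a : ℤ} {s : Hom X Y a} {t : Hom X Z a}
    {s' : Hom X' Y' a} {t' : Hom X' Z' a} (hs : IsShift X a Y s) (ht : IsShift X a Z t)
    (hs' : IsShift X' a Y' s') (ht' : IsShift X' a Z' t') (f : ZCat.mk X ⟶ ZCat.mk X')
    (p : ZCat.mk Y ⟶ ZCat.mk Y') (q : ZCat.mk Z ⟶ ZCat.mk Z')
    (hp : comp (zero_add a) p.1 s = comp (add_zero a) s' f.1)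
    (hq : comp (zero_add a) q.1 t = comp (add_zero a) t' f.1) :
    p ≫ (hs'.iso ht').hom = (hs.iso ht).hom ≫ q := by
  refine hs.zhom_ext ?_
  rw [ZCat.comp_val_comp, ZCat.comp_val_comp, hp, IsShift.iso_hom_comp, hq,
    ← assoc (ij := a) (hij := by lia) (h := by lia), IsShift.iso_hom_comp]

lemma isShift_zero (X : B) : IsShift X 0 X (one X) where
  d_eq := d_one X
  bijective Z k l h := by
    obtain rfl : k = l := by lia
    convert! Function.bijective_id (α := Hom X Z k) using 2 with φ
    exact comp_one _ φ

lemma IsShift.trans {X Y Z : B} {a b c : ℤ} {s : Hom X Y a} {t : Hom Y Z b}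
    (hs : IsShift X a Y s) (ht : IsShift Y b Z t) (h : b + a = c) :
    IsShift X c Z (comp h t s) where
  d_eq := d_comp_eq_zero _ _ _ _ ht.d_eq hs.d_eq
  bijective W k l hl := by
    convert! (hs.bijective W (k + b) l (by lia)).comp (ht.bijective W k (k + b) rfl) using 2 with φ
    exact (assoc _ _ _ _ _ _ _).symm

variable [IsPretriangulated B]

/-- A chosen shift `X[a]` of `X`. -/
noncomputable def shiftObj (X : B) (a : ℤ) : B :=
  (IsPretriangulated.exists_shift X a).choose

/-- The universal cycle in `B(X, X[a])_a`. -/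
noncomputable def shiftElt (X : B) (a : ℤ) : Hom X (shiftObj X a) a :=
  (IsPretriangulated.exists_shift X a).choose_spec.choose

lemma isShift_shiftElt (X : B) (a : ℤ) : IsShift X a (shiftObj X a) (shiftElt X a) :=
  (IsPretriangulated.exists_shift X a).choose_spec.choose_spec

/-- The closed morphism `φ[a] : X[a] ⟶ Y[a]` characterized by `φ[a] · s_X = s_Y · φ` for the
universal cycles `s`. -/
noncomputable def zShiftMap {X Y : B} (φ : ZCat.mk X ⟶ ZCat.mk Y) (a : ℤ) :
    ZCat.mk (shiftObj X a) ⟶ ZCat.mk (shiftObj Y a) :=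
  (isShift_shiftElt X a).zDesc (comp (add_zero a) (shiftElt Y a) φ.1)
    (d_comp_eq_zero _ _ _ _ (isShift_shiftElt _ _).d_eq (ZCat.d_val φ))

lemma zShiftMap_comp {X Y : B} (φ : ZCat.mk X ⟶ ZCat.mk Y) (a : ℤ) :
    comp (zero_add a) (zShiftMap φ a).1 (shiftElt X a) =
      comp (add_zero a) (shiftElt Y a) φ.1 :=
  (isShift_shiftElt X a).desc_comp _

lemma zShiftMap_id (X : B) (a : ℤ) : zShiftMap (𝟙 (ZCat.mk X)) a = 𝟙 _ :=
  (isShift_shiftElt X a).zhom_ext (by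
    rw [zShiftMap_comp]
    exact (comp_one _ _).trans (one_comp _ _).symm)

lemma zShiftMap_zcomp {X Y Z : B} (f : ZCat.mk X ⟶ ZCat.mk Y) (g : ZCat.mk Y ⟶ ZCat.mk Z)
    (a : ℤ) : zShiftMap (f ≫ g) a = zShiftMap f a ≫ zShiftMap g a :=
  (isShift_shiftElt X a).zhom_ext (by
    rw [ZCat.comp_val_comp, zShiftMap_comp, zShiftMap_comp,
      ← assoc (ij := a) (hij := by lia) (h := by lia), zShiftMap_comp,
      assoc (jk := 0) (hjk := by lia) (h' := by lia)]
    rfl)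

variable (B) in
/-- The shift functor `X ↦ X[a]` on the cycle category. -/
noncomputable def zShift (a : ℤ) : ZCat B ⥤ ZCat B where
  obj X := ⟨shiftObj X.as a⟩
  map φ := zShiftMap φ a
  map_id X := zShiftMap_id X.as a
  map_comp f g := zShiftMap_zcomp f g a

lemma zShiftMap_comp_assoc {X Y W : B} (φ : ZCat.mk X ⟶ ZCat.mk Y) (a : ℤ) {b c : ℤ}
    (t : Hom W X b) (h : a + b = c) :
    comp (zero_add c) (zShiftMap φ a).1 (comp h (shiftElt X a) t) =
      comp h (shiftElt Y a) (comp (zero_add b) φ.1 t) := by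
  rw [← assoc (ij := a) (hij := by lia) (h := by lia), zShiftMap_comp,
    assoc (jk := b) (hjk := by lia) (h' := by lia)]

variable (B) in
/-- The canonical isomorphism `X[0] ≅ X`. -/
noncomputable def zShiftZero : zShift B 0 ≅ 𝟭 (ZCat B) :=
  NatIso.ofComponents (fun X => (isShift_shiftElt X.as 0).iso (isShift_zero X.as))
    (fun {X Y} f => IsShift.iso_naturality (isShift_shiftElt X.as 0) (isShift_zero X.as)
      (isShift_shiftElt Y.as 0) (isShift_zero Y.as) f (zShiftMap f 0) f
      (zShiftMap_comp f 0) ((comp_one _ _).trans (one_comp _ _).symm))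

lemma isShift_add (X : B) (a b : ℤ) : IsShift X (a + b) (shiftObj (shiftObj X a) b)
    (comp (add_comm b a) (shiftElt (shiftObj X a) b) (shiftElt X a)) :=
  (isShift_shiftElt X a).trans (isShift_shiftElt (shiftObj X a) b) (add_comm b a)

variable (B) in
/-- The canonical isomorphism `X[a + b] ≅ X[a][b]`. -/
noncomputable def zShiftAdd (a b : ℤ) : zShift B (a + b) ≅ zShift B a ⋙ zShift B b :=
  NatIso.ofComponents (fun X => (isShift_shiftElt X.as (a + b)).iso (isShift_add X.as a b))
    (fun {X Y} f => IsShift.iso_naturality (isShift_shiftElt X.as (a + b)) (isShift_add X.as a b)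
      (isShift_shiftElt Y.as (a + b)) (isShift_add Y.as a b) f (zShiftMap f (a + b))
      (zShiftMap (zShiftMap f a) b) (zShiftMap_comp f (a + b)) (by
        refine (zShiftMap_comp_assoc (zShiftMap f a) b (shiftElt X.as a) (add_comm b a)).trans ?_
        rw [zShiftMap_comp]
        exact (assoc _ _ _ _ _ _ _).symm))

lemma eqToHom_comp_shiftElt (X : B) {a b : ℤ} (h : a = b)
    (p : ZCat.mk (shiftObj X a) = ZCat.mk (shiftObj X b)) :
    comp (by lia) (eqToHom p).1 (shiftElt X a) = shiftElt X b := by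
  subst h
  exact one_comp _ _

lemma zShift_assoc (m₁ m₂ m₃ : ℤ) (X : B)
    (p : ZCat.mk (shiftObj X (m₁ + m₂ + m₃)) = ZCat.mk (shiftObj X (m₁ + (m₂ + m₃)))) :
    ((isShift_shiftElt X (m₁ + m₂ + m₃)).iso (isShift_add X (m₁ + m₂) m₃)).hom ≫
      zShiftMap ((isShift_shiftElt X (m₁ + m₂)).iso (isShift_add X m₁ m₂)).hom m₃ =
    eqToHom p ≫ ((isShift_shiftElt X (m₁ + (m₂ + m₃))).iso (isShift_add X m₁ (m₂ + m₃))).hom ≫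
      ((isShift_shiftElt (shiftObj X m₁) (m₂ + m₃)).iso
        (isShift_add (shiftObj X m₁) m₂ m₃)).hom := by
  refine (isShift_shiftElt X (m₁ + m₂ + m₃)).zhom_ext ?_
  have key : ∀ (a : ℤ) (h : a = m₁ + (m₂ + m₃))
      (p : ZCat.mk (shiftObj X a) = ZCat.mk (shiftObj X (m₁ + (m₂ + m₃)))),
      comp (zero_add a) (eqToHom p ≫ ((isShift_shiftElt X (m₁ + (m₂ + m₃))).iso
        (isShift_add X m₁ (m₂ + m₃))).hom).1 (shiftElt X a) =
      comp (by lia) (shiftElt (shiftObj X m₁) (m₂ + m₃)) (shiftElt X m₁) := by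
    rintro _ rfl p
    rw [eqToHom_refl, Category.id_comp, IsShift.iso_hom_comp]
  rw [← Category.assoc, ZCat.comp_val_comp, ZCat.comp_val_comp, IsShift.iso_hom_comp, key _
    (by lia), zShiftMap_comp_assoc, IsShift.iso_hom_comp,
    ← assoc (ij := m₂ + m₃) (φ := Subtype.val _) (hij := by lia) (h := by lia),
    IsShift.iso_hom_comp, assoc (jk := m₁ + m₂) (hjk := by lia) (h' := by lia)]

lemma zShift_zero_add (n : ℤ) (X : B)
    (p : ZCat.mk (shiftObj X (0 + n)) = ZCat.mk (shiftObj X n)) :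
    ((isShift_shiftElt X (0 + n)).iso (isShift_add X 0 n)).hom =
      eqToHom p ≫ zShiftMap ((isShift_shiftElt X 0).iso (isShift_zero X)).inv n := by
  refine (isShift_shiftElt X (0 + n)).zhom_ext ?_
  have key : ∀ (a : ℤ) (h : a = n) (p : ZCat.mk (shiftObj X a) = ZCat.mk (shiftObj X n)),
      comp (zero_add a) (eqToHom p ≫
        zShiftMap ((isShift_shiftElt X 0).iso (isShift_zero X)).inv n).1 (shiftElt X a) =
      comp (by lia) (shiftElt (shiftObj X 0) n) (shiftElt X 0) := by
    rintro _ rfl p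
    rw [eqToHom_refl, Category.id_comp, zShiftMap_comp]
    congr 1
    exact (comp_one _ _).symm.trans (IsShift.iso_inv_comp _ _)
  rw [key _ (by lia), IsShift.iso_hom_comp]

lemma zShift_add_zero (n : ℤ) (X : B)
    (p : ZCat.mk (shiftObj X (n + 0)) = ZCat.mk (shiftObj X n)) :
    ((isShift_shiftElt X (n + 0)).iso (isShift_add X n 0)).hom =
      eqToHom p ≫ ((isShift_shiftElt (shiftObj X n) 0).iso
        (isShift_zero (shiftObj X n))).inv := by
  refine (isShift_shiftElt X (n + 0)).zhom_ext ?_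
  have key : ∀ (a : ℤ) (h : a = n) (p : ZCat.mk (shiftObj X a) = ZCat.mk (shiftObj X n)),
      comp (zero_add a) (eqToHom p ≫ ((isShift_shiftElt (shiftObj X n) 0).iso
        (isShift_zero (shiftObj X n))).inv).1 (shiftElt X a) =
      comp (by lia) (shiftElt (shiftObj X n) 0) (shiftElt X n) := by
    rintro _ rfl p
    rw [eqToHom_refl, Category.id_comp]
    congr 2
    exact (comp_one _ _).symm.trans (IsShift.iso_inv_comp _ _)
  rw [key _ (by lia), IsShift.iso_hom_comp]

noncomputable instance : HasShift (ZCat B) ℤ :=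
  hasShiftMk (ZCat B) ℤ
    { F := zShift B
      zero := zShiftZero B
      add := zShiftAdd B
      assoc_hom_app := fun m₁ m₂ m₃ X => zShift_assoc m₁ m₂ m₃ X.as _
      zero_add_hom_app := fun n X => zShift_zero_add n X.as _
      add_zero_hom_app := fun n X => zShift_add_zero n X.as _ }

lemma zShiftMap_add {X Y : B} (f g : ZCat.mk X ⟶ ZCat.mk Y) (a : ℤ) :
    zShiftMap (f + g) a = zShiftMap f a + zShiftMap g a :=
  (isShift_shiftElt X a).zhom_ext (by
    rw [zShiftMap_comp, ZCat.add_val, ZCat.add_val, map_add, map_add, AddMonoidHom.add_apply,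
      zShiftMap_comp, zShiftMap_comp])

instance (a : ℤ) : (shiftFunctor (ZCat B) a).Additive where
  map_add {X Y f g} := zShiftMap_add (X := X.as) (Y := Y.as) f g a

lemma homologous_zShiftMap {X Y : B} {f g : ZCat.mk X ⟶ ZCat.mk Y} (h : homologous B f g)
    (a : ℤ) : homologous B (zShiftMap f a) (zShiftMap g a) := by
  obtain ⟨h, hh⟩ := h
  obtain ⟨H, hH⟩ := ((isShift_shiftElt X a).bijective (shiftObj Y a) 1 (1 + a) rfl).2
    (a.negOnePow • comp (add_comm a 1) (shiftElt Y a) h)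
  refine ⟨H, (isShift_shiftElt X a).cancel (zero_add a) ?_⟩
  rw [map_sub, AddMonoidHom.sub_apply, zShiftMap_comp, zShiftMap_comp, ← map_sub,
    hh, ← d_comp_cycle (hk := by lia) (h := rfl) _ _ (isShift_shiftElt X a).d_eq]
  dsimp only at hH
  rw [hH, map_zsmul_units, d_cycle_comp (j' := 0) (hj := by lia) (h' := by lia) _ _
    (isShift_shiftElt Y a).d_eq, smul_smul, Int.units_mul_self, one_smul]

instance : (homologous B).IsCompatibleWithShift ℤ where
  condition a X Y _ _ h := homologous_zShiftMap (X := X.as) (Y := Y.as) h a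

instance (a : ℤ) : (shiftFunctor (HCat B) a).Additive := by
  have : (toH B ⋙ shiftFunctor (HCat B) a).Additive :=
    Functor.additive_of_iso ((toH B).commShiftIso a)
  exact Functor.additive_of_full_essSurj_comp (toH B) _

/-- The mapping cone triangle `X ⟶ Y ⟶ C ⟶ X[1]` of a closed morphism `f` in the cycle category,
where the third morphism corresponds to the cycle `p ∈ B(C, X)_{-1}`. -/
def IsConeTriangle (D : Triangle (ZCat B)) : Prop :=
  ∃ (u : Hom D.obj₁.as D.obj₃.as 1), IsCone D.mor₁.1 D.obj₃.as D.mor₂.1 u ∧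
    ∃ (p : Hom D.obj₃.as D.obj₁.as (-1)),
      comp (by lia) p D.mor₂.1 = (0 : Hom D.obj₂.as D.obj₁.as (-1)) ∧
      -comp (by lia) p u = one D.obj₁.as ∧
      D.mor₃.1 = comp (add_neg_cancel 1) (shiftElt D.obj₁.as 1) p

variable (B) in
/-- The distinguished triangles of the homology category: those isomorphic to the image of a mapping
cone triangle. -/
def distTriangles : Set (Triangle (HCat B)) :=
  {D | ∃ D' : Triangle (ZCat B), IsConeTriangle D' ∧ Nonempty (D ≅ (toH B).mapTriangle.obj D')}

end Shift

/-- A dg functor between dg categories. -/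
structure DGFunctor (B : Type u) [DGCategory.{v} B] (C : Type u') [DGCategory.{v'} C] where
  obj : B → C
  map : ∀ {X Y : B} {k : ℤ}, Hom X Y k →+ Hom (obj X) (obj Y) k
  map_d : ∀ {X Y : B} {i j : ℤ} (h : j + 1 = i) (φ : Hom X Y i),
    map (d i j h φ) = d i j h (map φ)
  map_one : ∀ (X : B), map (one X) = one (obj X)
  map_comp : ∀ {X Y Z : B} {i j k : ℤ} (h : i + j = k) (φ : Hom Y Z i) (ψ : Hom X Y j),
    map (comp h φ ψ) = comp h (map φ) (map ψ)

namespace DGFunctor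

variable {B : Type u} [DGCategory.{v} B] {C : Type u'} [DGCategory.{v'} C]

/-- Composition of dg functors. -/
def comp {D : Type w₁} [DGCategory.{w₂} D] (F : DGFunctor B C) (G : DGFunctor C D) :
    DGFunctor B D where
  obj X := G.obj (F.obj X)
  map := G.map.comp F.map
  map_d h φ := by simp [F.map_d, G.map_d]
  map_one X := by simp [F.map_one, G.map_one]
  map_comp h φ ψ := by simp [F.map_comp, G.map_comp]

/-- The functor on cycle categories induced by a dg functor. -/
def mapZ (F : DGFunctor B C) : ZCat B ⥤ ZCat C where
  obj X := ⟨F.obj X.as⟩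
  map f := ⟨F.map f.1, mem_cycles.2 (by rw [← F.map_d, ZCat.d_val f, map_zero])⟩
  map_id X := Subtype.ext (F.map_one X.as)
  map_comp f g := Subtype.ext (F.map_comp _ g.1 f.1)

/-- The functor on homology categories induced by a dg functor. -/
def mapH (F : DGFunctor B C) : HCat B ⥤ HCat C :=
  CategoryTheory.Quotient.lift (homologous B) (F.mapZ ⋙ toH C) (by
    rintro X Y f g ⟨h, hh⟩
    refine CategoryTheory.Quotient.sound _ ⟨F.map h, ?_⟩
    change F.map f.1 - F.map g.1 = _
    rw [← map_sub, hh, F.map_d]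
    rfl)

end DGFunctor

section Tensor

variable {B : Type u} [DGCategory.{v} B]

/-- Transport along an equality of degrees. -/
def castDeg {X Y : B} {i j : ℤ} (h : i = j) : Hom X Y i →+ Hom X Y j :=
  h ▸ AddMonoidHom.id (Hom X Y i)

@[simp] lemma castDeg_rfl {X Y : B} {i : ℤ} (φ : Hom X Y i) : castDeg rfl φ = φ := rfl

lemma d_castDeg {X Y : B} {i j k : ℤ} (h : i = j) (hk : k + 1 = j) (φ : Hom X Y i) :
    d j k hk (castDeg h φ) = d i k (by lia) φ := by
  subst h; rfl

lemma castDeg_d {X Y : B} {i j k : ℤ} (hj : j + 1 = i) (h : j = k) (φ : Hom X Y i) :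
    castDeg h (d i j hj φ) = d i k (by lia) φ := by
  subst h; rfl

lemma castDeg_comp {X Y Z : B} {i j k l : ℤ} (h : i + j = k) (e : k = l) (φ : Hom Y Z i)
    (ψ : Hom X Y j) : castDeg e (comp h φ ψ) = comp (by lia) φ ψ := by
  subst e; rfl

lemma comp_castDeg_left {X Y Z : B} {i i' j k : ℤ} (e : i = i') (h : i' + j = k) (φ : Hom Y Z i)
    (ψ : Hom X Y j) : comp h (castDeg e φ) ψ = comp (by lia) φ ψ := by
  subst e; rfl

lemma comp_castDeg_right {X Y Z : B} {i j j' k : ℤ} (e : j = j') (h : i + j' = k) (φ : Hom Y Z i)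
    (ψ : Hom X Y j) : comp h φ (castDeg e ψ) = comp (by lia) φ ψ := by
  subst e; rfl

lemma comp_smul_left {X Y Z : B} {i j k : ℤ} (h : i + j = k) (ε : ℤˣ) (φ : Hom Y Z i)
    (ψ : Hom X Y j) : comp h (ε • φ) ψ = ε • comp h φ ψ := by
  rw [map_zsmul_units, units_smul_apply]

/-- The objects of the dg category `ℤ[e] ⊗ B`, where `ℤ[e]` is the exterior algebra on a class `e`
of degree `1` with differential `d e = n`; they are the objects of `B`. -/
structure ZeTensor (n : ℕ) (B : Type u) where
  as : B

/-- The dg category `ℤ[e] ⊗ B` with `d e = n`: the pair `(φ, ψ)` with `φ ∈ B(X, Y)_k` and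
`ψ ∈ B(X, Y)_{k-1}` is the element `1 ⊗ φ + e ⊗ ψ` of `(ℤ[e] ⊗ B(X, Y))_k`. -/
instance (n : ℕ) : DGCategory.{v} (ZeTensor n B) where
  Hom X Y k := Hom X.as Y.as k × Hom X.as Y.as (k - 1)
  addCommGroup X Y k := inferInstance
  d i j h := AddMonoidHom.mk'
    (fun x => (d i j h x.1 + n • castDeg (by lia) x.2, -d (i - 1) (j - 1) (by lia) x.2))
    (fun x y => by
      ext
      · simp only [Prod.fst_add, Prod.snd_add, map_add, smul_add]; abel
      · simp only [Prod.snd_add, map_add]; abel)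
  comp {X Y Z i j k} h := AddMonoidHom.mk'
    (fun x => AddMonoidHom.mk'
      (fun y => (comp h x.1 y.1,
        comp (by lia) x.2 y.1 + i.negOnePow • comp (by lia) x.1 y.2))
      (fun y z => by
        ext
        · simp
        · simp only [Prod.fst_add, Prod.snd_add, map_add, smul_add]; abel))
    (fun x y => by
      ext z
      · simp
      · simp only [Prod.fst_add, Prod.snd_add, map_add, smul_add, AddMonoidHom.add_apply,
          AddMonoidHom.mk'_apply]
        abel)
  one X := (one X.as, 0)
  d_d i j k hij hjk x := by
    simp only [AddMonoidHom.mk'_apply]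
    ext
    · simp only [map_add, map_nsmul, d_d, map_neg, d_castDeg, castDeg_d, smul_neg]
      simp
    · simp [d_d]
  d_one X := by
    simp only [AddMonoidHom.mk'_apply]
    ext
    · simp [d_one]
    · simp
  one_comp h x := by
    simp only [AddMonoidHom.mk'_apply]
    ext
    · simp [one_comp]
    · simp [one_comp]
  comp_one h x := by
    simp only [AddMonoidHom.mk'_apply]
    ext
    · simp [comp_one]
    · simp [comp_one]
  assoc {W X Y Z i j k ij jk ijk} hij hjk h h' x y z := by
    simp only [AddMonoidHom.mk'_apply]
    ext
    · exact assoc _ _ _ _ _ _ _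
    · simp only [map_add, AddMonoidHom.add_apply, smul_add, map_zsmul_units, units_smul_apply,
        smul_smul, ← Int.negOnePow_add, hij]
      rw [add_assoc]
      congr 1
      · exact assoc _ _ _ _ _ _ _
      · congr 2 <;> exact assoc _ _ _ _ _ _ _
  leibniz {X Y Z i i' j j' k k'} hi hj hk h h₁ h₂ x y := by
    simp only [AddMonoidHom.mk'_apply]
    ext
    · simp only [Prod.fst_add, Prod.smul_fst, map_add, AddMonoidHom.add_apply, smul_add,
        castDeg_comp, map_zsmul_units, map_nsmul, AddMonoidHom.nsmul_apply, comp_castDeg_left,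
        comp_castDeg_right, nsmul_units_comm]
      rw [leibniz hi hj hk h h₁ h₂]
      abel
    · simp only [Prod.snd_add, Prod.smul_snd, map_add, map_neg, AddMonoidHom.add_apply,
        AddMonoidHom.neg_apply, smul_add, map_zsmul_units, map_nsmul, AddMonoidHom.nsmul_apply,
        comp_castDeg_left, comp_castDeg_right]
      rw [leibniz (i' := i' - 1) (j' := j') (by lia) (by lia) (by lia) (by lia) (by lia) (by lia),
        leibniz (i' := i') (j' := j' - 1) (by lia) (by lia) (by lia) (by lia) (by lia) (by lia)]
      obtain rfl : i = i' + 1 := hi.symm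
      simp only [Int.negOnePow_sub, Int.negOnePow_succ, Int.negOnePow_one, Units.neg_smul,
        smul_add, smul_neg, mul_neg, mul_one, neg_neg, smul_smul]
      abel

variable (B) in
/-- The dg functor `J : B ⟶ ℤ[e] ⊗ B`, `J(X) = X`, `J(φ) = 1 ⊗ φ`. -/
def ZeTensor.incl (n : ℕ) : DGFunctor B (ZeTensor n B) where
  obj X := ⟨X⟩
  map {X Y k} := AddMonoidHom.mk' (fun φ => ((φ, 0) : Hom X Y k × Hom X Y (k - 1)))
    (fun _ _ => Prod.ext rfl (add_zero (0 : Hom X Y (k - 1))).symm)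
  map_d {X Y i j} h φ := by
    change ((d i j h φ, 0) : Hom X Y j × Hom X Y (j - 1)) =
      (d i j h φ + n • castDeg _ (0 : Hom X Y (i - 1)), -d (i - 1) (j - 1) _ (0 : Hom X Y (i - 1)))
    simp
  map_one X := rfl
  map_comp {X Y Z i j k} h φ ψ := by
    change ((comp h φ ψ, 0) : Hom X Z k × Hom X Z (k - 1)) =
      (comp h φ ψ, comp _ (0 : Hom Y Z (i - 1)) ψ + i.negOnePow • comp _ φ (0 : Hom X Y (j - 1)))
    simp

/-- The element `1 ⊗ φ + e ⊗ ψ` of degree `k` of `(ℤ[e] ⊗ B)(X, Y)`. -/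
def ZeTensor.homMk (n : ℕ) {X Y : B} {k l : ℤ} (h : l + 1 = k) (φ : Hom X Y k) (ψ : Hom X Y l) :
    Hom (ZeTensor.mk X : ZeTensor n B) (ZeTensor.mk Y) k :=
  ((φ, castDeg (by lia) ψ) : Hom X Y k × Hom X Y (k - 1))

end Tensor

section Envelope

variable {C : Type u} [DGCategory.{v} C] {E : Type u'} [DGCategory.{v'} E]

/-- The smallest class of objects of `E` that contains the zero objects and the image of the dg
functor `ι`, and is closed under shifts and mapping cones (hence, as the case of the shift by `0`,
under isomorphism in the cycle category). -/
inductive GeneratedBy (ι : DGFunctor C E) : E → Prop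
  | of (X : C) : GeneratedBy ι (ι.obj X)
  | zero (Z : E) : IsZeroObj Z → GeneratedBy ι Z
  | shift {X : E} (a : ℤ) (Y : E) (s : Hom X Y a) :
      GeneratedBy ι X → IsShift X a Y s → GeneratedBy ι Y
  | cone {X Y : E} (f : Hom X Y 0) (Z : E) (i : Hom Y Z 0) (u : Hom X Z 1) :
      GeneratedBy ι X → GeneratedBy ι Y → IsClosed f → IsCone f Z i u → GeneratedBy ι Z

/-- A dg functor `ι : C ⟶ E` exhibits `E` as the pretriangulated envelope of `C`: `E` is
pretriangulated, `ι` is fully faithful (an isomorphism on morphism complexes), and every object of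
`E` is obtained from objects of `C` by finitely many shifts and mapping cones. -/
structure IsPretriangulatedEnvelope (ι : DGFunctor C E) : Prop where
  pretriangulated : IsPretriangulated E
  fullyFaithful : ∀ (X Y : C) (k : ℤ), Function.Bijective (ι.map (X := X) (Y := Y) (k := k))
  generated : ∀ Z : E, GeneratedBy ι Z

/-- For a dg functor `ι : ℤ[e] ⊗ B ⟶ E`, this structure says that the dg functor `t : E ⟶ B` sends
the object `X` of `ℤ[e] ⊗ B` to a mapping cone of `n · 1_X`, with universal `0`-cycle
`(η_X, g_X)`, and is given on morphisms of `ℤ[e] ⊗ B` by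
`t(1 ⊗ φ + e ⊗ ψ) · (η_X, g_X) = (η_Y φ + g_Y ψ, g_Y φ)`. Here the left hand side refers to the
action `θ · (a, b) = (θ a, (-1)^{|θ|} θ b)` of the module that the mapping cone represents. -/
structure ConeExtension {B : Type u} [DGCategory.{v} B] (n : ℕ)
    (ι : DGFunctor (ZeTensor n B) E) (t : DGFunctor E B) where
  η : ∀ X : B, Hom X (t.obj (ι.obj (ZeTensor.mk X))) 0
  g : ∀ X : B, Hom X (t.obj (ι.obj (ZeTensor.mk X))) 1
  isCone : ∀ X : B, IsCone (n • one X) (t.obj (ι.obj (ZeTensor.mk X))) (η X) (g X)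
  map_eta : ∀ {X Y : B} {k l : ℤ} (h : l + 1 = k) (φ : Hom X Y k) (ψ : Hom X Y l),
    comp (add_zero k) (t.map (ι.map (ZeTensor.homMk n h φ ψ))) (η X) =
      comp (zero_add k) (η Y) φ + comp (by lia) (g Y) ψ
  map_g : ∀ {X Y : B} {k l : ℤ} (h : l + 1 = k) (φ : Hom X Y k) (ψ : Hom X Y l),
    k.negOnePow • comp rfl (t.map (ι.map (ZeTensor.homMk n h φ ψ))) (g X) =
      comp (by lia) (g Y) φ

end Envelope

end DGCategory

section Triangulated

variable (T : Type u) [Category.{v} T] [HasZeroObject T] [Preadditive T] [HasShift T ℤ]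
  [∀ k : ℤ, (shiftFunctor T k).Additive] [Pretriangulated T]

/-- A triangulated category is algebraic if it is equivalent, as a triangulated category, to the
homology category of a pretriangulated dg category. -/
def IsAlgebraicTriangulated : Prop :=
  ∃ (B : Type u') (_ : DGCategory.{v'} B) (_ : DGCategory.IsPretriangulated B)
    (F : T ⥤ DGCategory.HCat B) (_ : F.CommShift ℤ), F.IsEquivalence ∧
      ∀ D : Triangle T,
        D ∈ distTriang T ↔ F.mapTriangle.obj D ∈ DGCategory.distTriangles B

variable {T}

/-- The object `X` has `n`-order at least `k`. Here `(Kn, π)` runs through the cones of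
multiplication by `n` on `K`, and `g` is an extension of `f`. -/
def OrderGE (n : ℕ) : ℕ → T → Prop
  | 0, _ => True
  | k + 1, X => ∀ (K : T) (f : K ⟶ X) (Kn : T) (π : K ⟶ Kn) (δ : Kn ⟶ K⟦(1 : ℤ)⟧),
      Triangle.mk (n • 𝟙 K) π δ ∈ distTriang T →
        ∃ g : Kn ⟶ X, π ≫ g = f ∧
          ∃ (C : T) (a : X ⟶ C) (b : C ⟶ Kn⟦(1 : ℤ)⟧),
            Triangle.mk g a b ∈ distTriang T ∧ OrderGE n k C

/-- The `n`-order of an object: the largest `k`, possibly infinite, such that the object has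
`n`-order at least `k`. -/
noncomputable def nOrder (n : ℕ) (X : T) : ℕ∞ := sSup {m : ℕ∞ | ∃ k : ℕ, m = k ∧ OrderGE n k X}

open ZeroObject in
variable (T) in
/-- The `n`-order of a triangulated category is the `n`-order of a zero object. -/
noncomputable def categoryNOrder (n : ℕ) : ℕ∞ := nOrder n (0 : T)

/-- The data and properties that make `ρ : T ⥤ S` with right adjoint `ρr` a mod-`n` reduction of
`T`. -/
structure ModReduction (n : ℕ) {S : Type u'} [Category.{v'} S] [HasZeroObject S] [Preadditive S]
    [HasShift S ℤ] [∀ k : ℤ, (shiftFunctor S k).Additive] [Pretriangulated S]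
    (ρ : T ⥤ S) (ρr : S ⥤ T) where
  commShift : ρ.CommShift ℤ
  exact : ρ.IsTriangulated
  adj : ρ ⊣ ρr
  exists_triangle : ∀ X : T, ∃ δ : ρr.obj (ρ.obj X) ⟶ X⟦(1 : ℤ)⟧,
    Triangle.mk (n • 𝟙 X) (adj.unit.app X) δ ∈ distTriang T

variable (T) in
/-- `T` has a mod-`n` reduction, given by a triangulated category `S` and functors `ρ` and
`ρr`. -/
def HasModReduction (n : ℕ) : Prop :=
  ∃ (S : Type u') (_ : Category.{v'} S) (_ : HasZeroObject S) (_ : Preadditive S)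
    (_ : HasShift S ℤ) (_ : ∀ k : ℤ, (shiftFunctor S k).Additive) (_ : Pretriangulated S)
    (_ : IsTriangulated S) (ρ : T ⥤ S) (ρr : S ⥤ T), Nonempty (ModReduction n ρ ρr)

end Triangulated

/-! The reduction is built from strict modules. Let an object of `EMod n B` be an object of B with
an endomorphism e of degree 1 such that e² = 0 and de = n, with morphisms those that commute with e
up to the Koszul sign. A mapping cone of n on X, with universal pair (i, u), is the free module ℤ[e]
⊗ X: e acts by e·i = u, so i is the summand 1 and u the summand e. A map out of a free module is
determined by its restriction along i. Hence ℤ[e] ⊗ B embeds fully faithfully as the free modules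
(`freeFunctor_bijective`), and free modules are left adjoint to forgetting e, with unit i
(`adjunctionZ`).

Shifts and cones of modules carry a module structure (`exists_isShift`, `exists_isCone`), so `EMod n
B` is pretriangulated, and the full subcategory generated by the free modules is an envelope of ℤ[e]
⊗ B. The adjunction already exists on cycle categories, so it descends to homology. The unit
triangle is the mapping cone triangle of n by construction.

The order statement is formal (`ModReduction.orderGE`). A map f : K ⟶ ρ^*Y has an adjoint transpose
f' : ρ_*K ⟶ Y, and ρ^*f' extends f along the unit, which is a cone of n on K. As the right adjoint
of an exact functor, ρ^* is exact, so the cone of ρ^*f' is ρ^* of a cone of f', and the argument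
repeats. A zero object is ρ^*0.

That homology categories are triangulated is proved by explicit homotopy equivalences between
iterated cones. A cone is encoded by the equations `ConeData` for its injections and projections, an
equality of morphisms is tested by their action on elements (`act_injective`), and the resulting
identities are settled by rewriting and commutative group algebra. -/

namespace DGCategory

/-! ### Morphisms as operators on families of elements -/

section Operators

variable {B : Type u} [DGCategory.{v} B]

/-- The group of all families of elements of the morphism groups into `X`. The morphisms of a dg
category act faithfully on these groups; this is used to verify identities between composites
without keeping track of degrees. -/
def Elts (X : B) : Type (max u v) := ∀ (W : B) (k : ℤ), Hom W X k

instance (X : B) : AddCommGroup (Elts X) :=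
  inferInstanceAs (AddCommGroup (∀ (W : B) (k : ℤ), Hom W X k))

/-- The differential on families of elements. -/
def eltD (X : B) : Elts X →+ Elts X :=
  AddMonoidHom.mk' (fun x W k => d (k + 1) k rfl (x W (k + 1)))
    (fun x y => by funext W k; exact map_add (d (k + 1) k rfl) (x W (k + 1)) (y W (k + 1)))

/-- The action of a morphism on families of elements. -/
def act {X Y : B} {i : ℤ} (φ : Hom X Y i) : Elts X →+ Elts Y :=
  AddMonoidHom.mk' (fun x W k => comp (add_sub_cancel i k) φ (x W (k - i)))
    (fun x y => by
      funext W k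
      exact map_add (comp (add_sub_cancel i k) φ) (x W (k - i)) (y W (k - i)))

lemma act_apply {X Y : B} {i : ℤ} (φ : Hom X Y i) (x : Elts X) (W : B) (k l : ℤ)
    (h : i + l = k) : act φ x W k = comp h φ (x W l) := by
  obtain rfl : l = k - i := by lia
  rfl

lemma eltD_apply (X : B) (x : Elts X) (W : B) (k l : ℤ) (h : k + 1 = l) :
    eltD X x W k = d l k h (x W l) := by
  subst h; rfl

/-- This is the Yoneda argument: evaluate at the family supported at the identity of X in degree 0.
-/
lemma act_injective {X Y : B} {i : ℤ} {φ ψ : Hom X Y i} (h : ∀ x, act φ x = act ψ x) :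
    φ = ψ := by
  classical
  have := congr_fun (congr_fun (h (Pi.single (M := fun W => ∀ k, Hom W X k) X
    (Pi.single (M := fun k => Hom X X k) 0 (one X)) : ∀ W k, Hom W X k)) X) i
  erw [act_apply φ _ X i 0 (add_zero i), act_apply ψ _ X i 0 (add_zero i)] at this
  simpa [comp_one] using this

lemma act_add {X Y : B} {i : ℤ} (φ ψ : Hom X Y i) (x : Elts X) :
    act (φ + ψ) x = act φ x + act ψ x := by
  funext W k
  exact congr($(map_add (comp (add_sub_cancel i k)) φ ψ) (x W (k - i)))

lemma act_neg {X Y : B} {i : ℤ} (φ : Hom X Y i) (x : Elts X) :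
    act (-φ) x = -act φ x := by
  funext W k
  exact congr($(map_neg (comp (add_sub_cancel i k)) φ) (x W (k - i)))

lemma act_sub {X Y : B} {i : ℤ} (φ ψ : Hom X Y i) (x : Elts X) :
    act (φ - ψ) x = act φ x - act ψ x := by
  funext W k
  exact congr($(map_sub (comp (add_sub_cancel i k)) φ ψ) (x W (k - i)))

lemma act_zero {X Y : B} {i : ℤ} (x : Elts X) : act (0 : Hom X Y i) x = 0 := by
  funext W k
  exact congr($(map_zero (comp (add_sub_cancel i k))) (x W (k - i)))

lemma act_zsmul {X Y : B} {i : ℤ} (n : ℤ) (φ : Hom X Y i) (x : Elts X) :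
    act (n • φ) x = n • act φ x := by
  funext W k
  exact congr($(map_zsmul (comp (add_sub_cancel i k)) n φ) (x W (k - i)))

lemma act_nsmul {X Y : B} {i : ℤ} (n : ℕ) (φ : Hom X Y i) (x : Elts X) :
    act (n • φ) x = n • act φ x := by
  rw [← natCast_zsmul, act_zsmul, natCast_zsmul]

lemma act_units_smul {X Y : B} {i : ℤ} (ε : ℤˣ) (φ : Hom X Y i) (x : Elts X) :
    act (ε • φ) x = ε • act φ x := by
  rw [Units.smul_def, act_zsmul, Units.smul_def]

lemma act_comp {X Y Z : B} {i j k : ℤ} (h : i + j = k) (φ : Hom Y Z i) (ψ : Hom X Y j)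
    (x : Elts X) : act (comp h φ ψ) x = act φ (act ψ x) := by
  funext W l
  rw [act_apply φ _ W l (l - i) (by lia), act_apply ψ _ W (l - i) (l - k) (by lia),
    act_apply _ _ W l (l - k) (by lia)]
  exact assoc _ _ _ _ _ _ _

lemma act_act {X Y Z : B} {i j k : ℤ} {h : i + j = k} {φ : Hom Y Z i} {ψ : Hom X Y j}
    {χ : Hom X Z k} (e : comp h φ ψ = χ) (x : Elts X) : act φ (act ψ x) = act χ x := by
  rw [← e, act_comp]

lemma act_one (X : B) (x : Elts X) : act (one X) x = x := by
  funext W k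
  rw [act_apply _ _ W k k (by lia)]
  exact one_comp _ _

lemma act_castDeg {X Y : B} {i j : ℤ} (h : i = j) (φ : Hom X Y i) (x : Elts X) :
    act (castDeg h φ) x = act φ x := by
  subst h; rfl

/-- The Leibniz rule solved for the first term. The differential of a morphism becomes a graded
commutator with `eltD`, so being a cycle means commuting with `eltD` up to sign. -/
lemma act_d {X Y : B} {i j : ℤ} (h : j + 1 = i) (φ : Hom X Y i) (x : Elts X) :
    act (d i j h φ) x = eltD Y (act φ x) - i.negOnePow • act φ (eltD X x) := by
  funext W k
  change _ = eltD Y (act φ x) W k - i.negOnePow • act φ (eltD X x) W k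
  rw [act_apply _ _ W k (k - j) (by lia), eltD_apply _ _ W k _ rfl,
    act_apply φ x W (k + 1) (k - j) (by lia), act_apply φ _ W k (k - i) (by lia),
    eltD_apply _ _ W _ (k - j) (by lia),
    leibniz (i' := j) (j' := k - i) (by lia) (by lia) (by lia) (by lia) (by lia) (by lia)]
  abel

lemma map_units_smul_act {X Y : B} {i : ℤ} (φ : Hom X Y i) (ε : ℤˣ) (x : Elts X) :
    act φ (ε • x) = ε • act φ x := map_zsmul_units _ _ _

lemma eltD_units_smul {X : B} (ε : ℤˣ) (x : Elts X) :
    eltD X (ε • x) = ε • eltD X x := map_zsmul_units _ _ _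

lemma eltD_act {X Y : B} {i : ℤ} {φ : Hom X Y i} (hφ : d i (i - 1) (by lia) φ = 0)
    (x : Elts X) : eltD Y (act φ x) = i.negOnePow • act φ (eltD X x) := by
  have := act_d (j := i - 1) (by lia) φ x
  rw [hφ, act_zero] at this
  exact (sub_eq_zero.1 this.symm)

lemma IsClosed.eltD_act {X Y : B} {φ : Hom X Y 0} (hφ : IsClosed φ)
    (x : Elts X) : eltD Y (act φ x) = act φ (eltD X x) := by
  simpa using DGCategory.eltD_act (i := 0) hφ x

lemma isClosed_of_eltD_act {X Y : B} {φ : Hom X Y 0}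
    (h : ∀ x, eltD Y (act φ x) = act φ (eltD X x)) : IsClosed φ :=
  act_injective (fun x => by rw [act_d, h, act_zero]; simp)

lemma d_eq_zero_of_eltD_act {X Y : B} {i j : ℤ} (hj : j + 1 = i) {φ : Hom X Y i}
    (h : ∀ x, eltD Y (act φ x) = i.negOnePow • act φ (eltD X x)) : d i j hj φ = 0 :=
  act_injective (fun x => by rw [act_d, h, act_zero, sub_self])

lemma act_eq_of_eq {X Y : B} {i : ℤ} {φ ψ : Hom X Y i} (h : φ = ψ) (x : Elts X) :
    act φ x = act ψ x := by rw [h]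

end Operators

/-! ### Mapping cones and shifts by equations -/

section ConeData

variable {B : Type u} [DGCategory.{v} B]

/-- A mapping cone `(C, i, u)` of `f` together with the projections `p` and `q`, in equational
form. -/
structure ConeData {X Y : B} (f : Hom X Y 0) (C : B) (i : Hom Y C 0) (u : Hom X C 1)
    (p : Hom C X (-1)) (q : Hom C Y 0) : Prop where
  d_inl : d 0 (-1) (by lia) i = 0
  d_inr : d 1 0 (by lia) u = comp (by lia) i f
  p_inl : comp (by lia) p i = (0 : Hom Y X (-1))
  p_inr : comp (by lia) p u = -one X
  q_inl : comp (by lia) q i = one Y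
  q_inr : comp (by lia) q u = (0 : Hom X Y 1)
  total : comp (by lia) i q = one C + comp (by lia) u p

namespace ConeData

variable {X Y C : B} {f : Hom X Y 0} {i : Hom Y C 0} {u : Hom X C 1} {p : Hom C X (-1)}
  {q : Hom C Y 0} (h : ConeData f C i u p q)

include h

lemma act_p_inl (x : Elts Y) : act p (act i x) = 0 := by
  rw [act_act h.p_inl, act_zero]

lemma act_p_inr (x : Elts X) : act p (act u x) = -x := by
  rw [act_act h.p_inr, act_neg, act_one]

lemma act_q_inl (x : Elts Y) : act q (act i x) = x := by
  rw [act_act h.q_inl, act_one]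

lemma act_q_inr (x : Elts X) : act q (act u x) = 0 := by
  rw [act_act h.q_inr, act_zero]

/-- As a rewriting rule this eliminates i q in favour of u p. Together with the relations for p i, p
u, q i and q u it brings composites through a cone to a normal form. -/
lemma act_inl_q (x : Elts C) : act i (act q x) = x + act u (act p x) := by
  rw [act_act h.total, act_add, act_one, act_comp]

lemma eltD_inl (x : Elts Y) : eltD C (act i x) = act i (eltD Y x) := IsClosed.eltD_act h.d_inl x

lemma eltD_inr (x : Elts X) : eltD C (act u x) = act i (act f x) - act u (eltD X x) := by
  have := act_d (j := 0) (by lia) u x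
  rw [h.d_inr, act_comp] at this
  rw [this]
  simp

/-- The differentials of p and q are forced by those of i and u: differentiate i q = 1 + u p, then
apply p to get dp = 0, or q to get dq = f p. -/
lemma eltD_p (x : Elts C) : eltD X (act p x) = -act p (eltD C x) := by
  have h₁ := congr(act p (eltD C $(h.act_inl_q x)))
  rw [h.eltD_inl, map_add, h.eltD_inr, h.act_p_inl, map_add, map_sub, h.act_p_inl,
    h.act_p_inr] at h₁
  rw [zero_sub, neg_neg] at h₁
  exact (eq_neg_of_add_eq_zero_right h₁.symm)

lemma eltD_q (x : Elts C) : eltD Y (act q x) = act f (act p x) + act q (eltD C x) := by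
  have h₁ := congr(act q (eltD C $(h.act_inl_q x)))
  rw [h.eltD_inl, map_add, h.eltD_inr, h.act_q_inl, map_add, map_sub, h.act_q_inl,
    h.act_q_inr, sub_zero] at h₁
  rw [h₁, add_comm]

/-- Since 1 = i q - u p, a morphism φ out of C equals (φ i) q - (φ u) p. This gives injectivity and
also the formula for a preimage. -/
lemma isCone : IsCone f C i u where
  d_inl := h.d_inl
  d_inr := h.d_inr
  bijective Z k l hl := by
    constructor
    · intro φ ψ e
      obtain ⟨e₁, e₂⟩ := Prod.ext_iff.1 e
      dsimp only at e₁ e₂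
      replace e₂ := MulAction.injective k.negOnePow e₂
      refine act_injective (fun x => ?_)
      have h₁ := h.act_inl_q x
      rw [← sub_eq_iff_eq_add] at h₁
      rw [← h₁, map_sub, map_sub, act_act e₁, act_act e₂, act_comp, act_comp]
    · rintro ⟨a, b⟩
      refine ⟨comp (by lia) a q - k.negOnePow • comp (by lia) b p, Prod.ext ?_ ?_⟩
      · refine act_injective (fun x => ?_)
        simp only [act_comp, act_sub, act_units_smul, h.act_q_inl, h.act_p_inl, map_zero, smul_zero,
          sub_zero]
      · refine act_injective (fun x => ?_)
        simp only [act_comp, act_sub, act_units_smul, h.act_q_inr, h.act_p_inr, map_zero,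
          zero_sub, map_neg, smul_neg, neg_neg, smul_smul, Int.units_mul_self, one_smul]

end ConeData

lemma IsCone.hom_ext {X Y C : B} {f : Hom X Y 0} {i : Hom Y C 0} {u : Hom X C 1}
    (h : IsCone f C i u) {Z : B} {k : ℤ} {φ ψ : Hom C Z k}
    (h₁ : ∀ x, act φ (act i x) = act ψ (act i x)) (h₂ : ∀ x, act φ (act u x) = act ψ (act u x)) :
    φ = ψ := by
  refine (h.bijective Z k (k + 1) rfl).1 (Prod.ext ?_ ?_)
  · exact act_injective (fun x => by simp only [act_comp, h₁])
  · exact act_injective (fun x => by simp only [act_units_smul, act_comp, h₂])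

/-- The universal property yields p from (0, 1_X) and q from (1_Y, 0). The relation i q = 1 + u p
then holds because both sides agree on i and on u. -/
lemma IsCone.exists_coneData {X Y C : B} {f : Hom X Y 0} {i : Hom Y C 0} {u : Hom X C 1}
    (h : IsCone f C i u) : ∃ (p : Hom C X (-1)) (q : Hom C Y 0), ConeData f C i u p q := by
  obtain ⟨p, ⟨hp₁, hp₂⟩, -⟩ := h.existsUnique_p
  obtain ⟨q, hq⟩ := (h.bijective Y 0 1 (by lia)).2 (one Y, 0)
  obtain ⟨hq₁, hq₂⟩ := Prod.ext_iff.1 hq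
  simp only [Int.negOnePow_zero, one_smul] at hq₁ hq₂
  rw [neg_eq_iff_eq_neg] at hp₂
  have e₁ (x) : act p (act i x) = 0 := by rw [act_act hp₁, act_zero]
  have e₂ (x) : act p (act u x) = -x := by rw [act_act hp₂, act_neg, act_one]
  have e₃ (x) : act q (act i x) = x := by rw [act_act hq₁, act_one]
  have e₄ (x) : act q (act u x) = 0 := by rw [act_act hq₂, act_zero]
  refine ⟨p, q, h.d_inl, h.d_inr, hp₁, hp₂, hq₁, hq₂, h.hom_ext (fun x => ?_) (fun x => ?_)⟩
  · simp [act_add, act_comp, act_one, e₁, e₃]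
  · simp [act_add, act_comp, act_one, e₂, e₄]

/-- If `s : X ⟶ Y` is a cycle of degree `a` with inverse `s'`, then `Y` is a shift of `X`. -/
lemma isShift_of_inverse {X Y : B} {a b : ℤ} (hab : a + b = 0) {s : Hom X Y a} {s' : Hom Y X b}
    (hs : d a (a - 1) (by lia) s = 0) (h₁ : comp (by lia) s' s = one X)
    (h₂ : comp hab s s' = one Y) : IsShift X a Y s where
  d_eq := hs
  bijective Z k l hl := by
    have e₁ (x) : act s' (act s x) = x := by rw [act_act h₁, act_one]
    have e₂ (x) : act s (act s' x) = x := by rw [← act_comp hab, h₂, act_one]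
    constructor
    · intro φ ψ e
      refine act_injective (fun x => ?_)
      rw [← e₂ x, ← act_comp hl, ← act_comp hl]
      exact congr(act $e _)
    · intro ψ
      exact ⟨comp (by lia) ψ s', act_injective (fun x => by simp only [act_comp, e₁])⟩

/-- Lifting 1_X through s gives a left inverse s'. It is also a right inverse because s s' and 1
agree after composition with s. -/
lemma IsShift.exists_inverse {X Y : B} {a b : ℤ} (hab : a + b = 0) {s : Hom X Y a}
    (hs : IsShift X a Y s) : ∃ s' : Hom Y X b, d b (b - 1) (by lia) s' = 0 ∧
      (∀ x, act s' (act s x) = x) ∧ (∀ x, act s (act s' x) = x) := by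
  obtain ⟨s', h⟩ := (hs.bijective X b 0 (by lia)).2 (one X)
  have e₁ (x) : act s' (act s x) = x := (act_act h x).trans (act_one X x)
  have e₂ : comp hab s s' = one Y := by
    refine hs.cancel (zero_add a) (act_injective (fun x => ?_))
    simp only [act_comp, act_one, e₁]
  have e₃ (x) : act s (act s' x) = x := by rw [← act_comp hab, e₂, act_one]
  refine ⟨s', d_eq_zero_of_eltD_act _ (fun x => ?_), e₁, e₃⟩
  -- Applying s' to the differential of s s' x = x shows that s' is a cycle.
  have := congr(act s' $(eltD_act hs.d_eq (act s' x)))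
  rw [e₃, map_units_smul_act, e₁] at this
  rw [this, smul_smul, ← Int.negOnePow_add, show b + a = 0 by lia]
  simp

end ConeData

/-! ### Homotopies and the shift in terms of elements -/

section Calculus

variable {B : Type u} [DGCategory.{v} B]

/-- Composition of homogeneous morphisms, in the degree that is the sum of the two degrees. -/
def cmul {X Y Z : B} {i j : ℤ} (φ : Hom Y Z i) (ψ : Hom X Y j) : Hom X Z (i + j) :=
  comp rfl φ ψ

lemma act_cmul {X Y Z : B} {i j : ℤ} (φ : Hom Y Z i) (ψ : Hom X Y j) (x : Elts X) :
    act (cmul φ ψ) x = act φ (act ψ x) := act_comp _ _ _ _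

lemma ZCat.eltD_act {X Y : ZCat B} (f : X ⟶ Y) (x : Elts X.as) :
    eltD Y.as (act f.1 x) = act f.1 (eltD X.as x) := IsClosed.eltD_act (ZCat.d_val f) x

lemma ZCat.act_comp_val {X Y Z : ZCat B} (f : X ⟶ Y) (g : Y ⟶ Z) (x : Elts X.as) :
    act (f ≫ g).1 x = act g.1 (act f.1 x) := act_comp _ _ _ _

lemma ZCat.act_id_val (X : ZCat B) (x : Elts X.as) :
    act (𝟙 X : X ⟶ X).1 x = x := act_one _ _

lemma ZCat.act_neg_val {X Y : ZCat B} (f : X ⟶ Y) (x : Elts X.as) :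
    act (-f).1 x = -act f.1 x := act_neg _ _

lemma ZCat.hom_ext_act {X Y : ZCat B} {f g : X ⟶ Y} (h : ∀ x, act f.1 x = act g.1 x) : f = g :=
  ZCat.hom_ext (act_injective h)

/-- A morphism of degree `0` that commutes with the differentials of families of elements, as a
morphism of the cycle category. -/
def zmk {X Y : ZCat B} (f : Hom X.as Y.as 0)
    (h : ∀ x, eltD Y.as (act f x) = act f (eltD X.as x)) : X ⟶ Y :=
  ⟨f, isClosed_of_eltD_act h⟩

@[simp] lemma zmk_val {X Y : ZCat B} (f : Hom X.as Y.as 0)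
    (h : ∀ x, eltD Y.as (act f x) = act f (eltD X.as x)) : (zmk f h).1 = f := rfl

lemma toH_map_eq {X Y : ZCat B} {f g : X ⟶ Y} (H : Hom X.as Y.as 1)
    (h : ∀ x, act f.1 x - act g.1 x = eltD Y.as (act H x) + act H (eltD X.as x)) :
    (toH B).map f = (toH B).map g := by
  refine CategoryTheory.Quotient.sound _ ⟨H, act_injective (fun x => ?_)⟩
  rw [act_sub, h, act_d]
  simp

/-- The differential of H x stands alone on the left so that the equation can serve as a rewriting
rule. -/
lemma exists_homotopy {X Y : ZCat B} {f g : X ⟶ Y} (h : (toH B).map f = (toH B).map g) :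
    ∃ H : Hom X.as Y.as 1,
      ∀ x, eltD Y.as (act H x) = act f.1 x - act g.1 x - act H (eltD X.as x) := by
  obtain ⟨H, hH⟩ := (CategoryTheory.Quotient.functor_map_eq_iff (homologous B) f g).1 h
  refine ⟨H, fun x => ?_⟩
  have := act_eq_of_eq hH x
  rw [act_sub, act_d] at this
  rw [this]
  simp

lemma act_inv_of_act_hom {X Y : ZCat B} (e : X ≅ Y) {φ : Elts Y.as → Elts X.as}
    (h : ∀ x, act e.hom.1 (φ x) = x) (x : Elts Y.as) : act e.inv.1 x = φ x := by
  conv_lhs => rw [← h x]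
  rw [← ZCat.act_comp_val, e.hom_inv_id, ZCat.act_id_val]

variable [IsPretriangulated B]

/-- The universal cycle in `B(X, X[a])_a`, for an object `X` of the cycle category. -/
noncomputable def sElt (X : ZCat B) (a : ℤ) : Hom X.as (X⟦a⟧).as a := shiftElt X.as a

lemma isShift_sElt (X : ZCat B) (a : ℤ) : IsShift X.as a (X⟦a⟧).as (sElt X a) :=
  isShift_shiftElt X.as a

/-- The inverse of the universal cycle `sElt X a`. -/
noncomputable def tElt (X : ZCat B) (a : ℤ) : Hom (X⟦a⟧).as X.as (-a) :=
  ((isShift_sElt X a).exists_inverse (add_neg_cancel a)).choose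

lemma act_tElt_sElt (X : ZCat B) (a : ℤ) (x : Elts X.as) :
    act (tElt X a) (act (sElt X a) x) = x :=
  ((isShift_sElt X a).exists_inverse (add_neg_cancel a)).choose_spec.2.1 x

lemma act_sElt_tElt (X : ZCat B) (a : ℤ) (x : Elts (X⟦a⟧).as) :
    act (sElt X a) (act (tElt X a) x) = x :=
  ((isShift_sElt X a).exists_inverse (add_neg_cancel a)).choose_spec.2.2 x

lemma eltD_act_sElt (X : ZCat B) (a : ℤ) (x : Elts X.as) :
    eltD _ (act (sElt X a) x) = a.negOnePow • act (sElt X a) (eltD _ x) :=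
  eltD_act (isShift_sElt X a).d_eq x

lemma d_tElt (X : ZCat B) (a : ℤ) : d (-a) (-a - 1) (by lia) (tElt X a) = 0 :=
  ((isShift_sElt X a).exists_inverse (add_neg_cancel a)).choose_spec.1

lemma eltD_act_tElt (X : ZCat B) (a : ℤ) (x : Elts (X⟦a⟧).as) :
    eltD _ (act (tElt X a) x) = a.negOnePow • act (tElt X a) (eltD _ x) := by
  have := eltD_act (d_tElt X a) x
  rwa [Int.negOnePow_neg] at this

lemma eltD_act_sElt_one (X : ZCat B) (x : Elts X.as) :
    eltD _ (act (sElt X 1) x) = -act (sElt X 1) (eltD _ x) := by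
  simp [eltD_act_sElt]

lemma eltD_act_tElt_one (X : ZCat B) (x : Elts (X⟦(1 : ℤ)⟧).as) :
    eltD _ (act (tElt X 1) x) = -act (tElt X 1) (eltD _ x) := by
  simp [eltD_act_tElt]

lemma eltD_act_sElt_neg_one (X : ZCat B) (x : Elts X.as) :
    eltD _ (act (sElt X (-1)) x) = -act (sElt X (-1)) (eltD _ x) := by
  simp [eltD_act_sElt]

lemma eltD_act_tElt_neg_one (X : ZCat B) (x : Elts (X⟦(-1 : ℤ)⟧).as) :
    eltD _ (act (tElt X (-1)) x) = -act (tElt X (-1)) (eltD _ x) := by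
  simp [eltD_act_tElt]

lemma act_shift_map {X Y : ZCat B} (f : X ⟶ Y) (a : ℤ) (x : Elts (X⟦a⟧).as) :
    act (f⟦a⟧').1 x = act (sElt Y a) (act f.1 (act (tElt X a) x)) := by
  conv_lhs => rw [← act_sElt_tElt X a x]
  exact (act_act (zShiftMap_comp (X := X.as) (Y := Y.as) f a) _).trans (act_comp _ _ _ _)

/-- The structure isomorphisms of the shift are characterized by preserving universal cycles. Here
and in the lemmas below they are expressed through the cycles s and their inverses t, which then
cancel in computations. -/
lemma act_shiftFunctorZero_hom (X : ZCat B) (x : Elts (X⟦(0 : ℤ)⟧).as) :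
    act (Y := X.as) ((shiftFunctorZero (ZCat B) ℤ).hom.app X).1 x = act (tElt X 0) x := by
  conv_lhs => rw [← act_sElt_tElt X 0 x]
  have : (shiftFunctorZero (ZCat B) ℤ) = zShiftZero B := ShiftMkCore.shiftFunctorZero_eq _
  rw [this]
  exact (act_act (IsShift.iso_hom_comp (isShift_shiftElt X.as 0) (isShift_zero X.as)) _).trans
    (act_one _ _)

lemma act_shiftFunctorAdd_hom (X : ZCat B) (a b : ℤ) (x : Elts (X⟦a + b⟧).as) :
    act (Y := (X⟦a⟧⟦b⟧).as) ((shiftFunctorAdd (ZCat B) a b).hom.app X).1 x =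
      act (sElt (X⟦a⟧) b) (act (sElt X a) (act (tElt X (a + b)) x)) := by
  conv_lhs => rw [← act_sElt_tElt X (a + b) x]
  have : (shiftFunctorAdd (ZCat B) a b) = zShiftAdd B a b := ShiftMkCore.shiftFunctorAdd_eq _ _ _
  rw [this]
  exact (act_act (IsShift.iso_hom_comp (isShift_shiftElt X.as (a + b))
    (isShift_add X.as a b)) _).trans (act_comp _ _ _ _)

lemma act_shiftFunctorAdd'_hom (X : ZCat B) (a b c : ℤ) (h : a + b = c)
    (x : Elts (X⟦c⟧).as) :
    act (Y := (X⟦a⟧⟦b⟧).as) ((shiftFunctorAdd' (ZCat B) a b c h).hom.app X).1 x =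
      act (sElt (X⟦a⟧) b) (act (sElt X a) (act (tElt X c) x)) := by
  subst h
  rw [shiftFunctorAdd'_eq_shiftFunctorAdd]
  exact act_shiftFunctorAdd_hom X a b x

lemma act_shiftFunctorZero_inv (X : ZCat B) (x : Elts X.as) :
    act (X := X.as) ((shiftFunctorZero (ZCat B) ℤ).inv.app X).1 x = act (sElt X 0) x :=
  act_inv_of_act_hom ((shiftFunctorZero (ZCat B) ℤ).app X)
    (φ := fun x => act (sElt X 0) x)
    (fun _ => (act_shiftFunctorZero_hom X _).trans (act_tElt_sElt _ _ _)) x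

lemma act_shiftFunctorAdd_inv (X : ZCat B) (a b : ℤ) (x : Elts (X⟦a⟧⟦b⟧).as) :
    act (X := (X⟦a⟧⟦b⟧).as) ((shiftFunctorAdd (ZCat B) a b).inv.app X).1 x =
      act (sElt X (a + b)) (act (tElt X a) (act (tElt (X⟦a⟧) b) x)) := by
  refine act_inv_of_act_hom ((shiftFunctorAdd (ZCat B) a b).app X)
    (φ := fun x => act (sElt X (a + b)) (act (tElt X a) (act (tElt (X⟦a⟧) b) x)))
    (fun x => (act_shiftFunctorAdd_hom X a b _).trans ?_) x
  change Elts (X⟦a⟧⟦b⟧).as at x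
  rw [act_tElt_sElt, act_sElt_tElt, act_sElt_tElt]

lemma act_shiftFunctorCompIsoId_inv (X : ZCat B) (a b : ℤ) (h : a + b = 0) (x : Elts X.as) :
    act (X := X.as) (Y := (X⟦a⟧⟦b⟧).as)
      ((shiftFunctorCompIsoId (ZCat B) a b h).inv.app X).1 x =
      act (sElt (X⟦a⟧) b) (act (sElt X a) x) := by
  refine (ZCat.act_comp_val ((shiftFunctorZero (ZCat B) ℤ).inv.app X)
    ((shiftFunctorAdd' (ZCat B) a b 0 h).hom.app X) x).trans
    ((act_shiftFunctorAdd'_hom X a b 0 h _).trans ?_)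
  erw [act_shiftFunctorZero_inv]
  rw [act_tElt_sElt]

lemma act_shiftFunctorCompIsoId_hom (X : ZCat B) (a b : ℤ) (h : a + b = 0)
    (x : Elts (X⟦a⟧⟦b⟧).as) :
    act (X := (X⟦a⟧⟦b⟧).as) (Y := X.as)
      ((shiftFunctorCompIsoId (ZCat B) a b h).hom.app X).1 x =
      act (tElt X a) (act (tElt (X⟦a⟧) b) x) := by
  refine act_inv_of_act_hom ((shiftFunctorCompIsoId (ZCat B) a b h).symm.app X)
    (φ := fun x => act (tElt X a) (act (tElt (X⟦a⟧) b) x))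
    (fun x => (act_shiftFunctorCompIsoId_inv X a b h _).trans ?_) x
  change Elts (X⟦a⟧⟦b⟧).as at x
  rw [act_sElt_tElt, act_sElt_tElt]

end Calculus

/-! ### Cone triangles in the homology category -/

section Pretriangulated

variable {B : Type u} [DGCategory.{v} B] [IsPretriangulated B]

/-- The third morphism `C ⟶ X[1]` of a mapping cone triangle. -/
noncomputable def ConeData.toShift {X Y C : ZCat B} {f : X ⟶ Y} {i : Hom Y.as C.as 0}
    {u : Hom X.as C.as 1} {p : Hom C.as X.as (-1)} {q : Hom C.as Y.as 0}
    (h : ConeData f.1 C.as i u p q) : C ⟶ X⟦(1 : ℤ)⟧ :=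
  zmk (castDeg (by lia) (cmul (sElt X 1) p)) (fun x => by
    simp only [act_castDeg, act_cmul, eltD_act_sElt_one, h.eltD_p, map_neg, neg_neg])

lemma ConeData.act_toShift {X Y C : ZCat B} {f : X ⟶ Y} {i : Hom Y.as C.as 0}
    {u : Hom X.as C.as 1} {p : Hom C.as X.as (-1)} {q : Hom C.as Y.as 0}
    (h : ConeData f.1 C.as i u p q) (x : Elts C.as) :
    act h.toShift.1 x = act (sElt X 1) (act p x) := by
  simp only [toShift, zmk_val, act_castDeg, act_cmul]

lemma ConeData.isConeTriangle {X Y C : ZCat B} {f : X ⟶ Y} {i : Y ⟶ C}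
    {u : Hom X.as C.as 1} {p : Hom C.as X.as (-1)} {q : Hom C.as Y.as 0}
    (h : ConeData f.1 C.as i.1 u p q) : IsConeTriangle (Triangle.mk f i h.toShift) :=
  ⟨u, h.isCone, p, h.p_inl, by rw [neg_eq_iff_eq_neg]; exact h.p_inr, rfl⟩

lemma exists_coneData {X Y : ZCat B} (f : X ⟶ Y) : ∃ (C : ZCat B) (i : Y ⟶ C)
    (u : Hom X.as C.as 1) (p : Hom C.as X.as (-1)) (q : Hom C.as Y.as 0),
      ConeData f.1 C.as i.1 u p q := by
  obtain ⟨C, i, u, h⟩ := IsPretriangulated.exists_cone f.1 (ZCat.d_val f)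
  obtain ⟨p, q, h'⟩ := h.exists_coneData
  exact ⟨⟨C⟩, ⟨i, h.d_inl⟩, u, p, q, h'⟩

/-- The p of the triangle is the p of the cone data, since its values on i and u determine it; hence
the third morphism is the standard one. -/
lemma IsConeTriangle.exists_coneData {D : Triangle (ZCat B)} (hD : IsConeTriangle D) :
    ∃ (u : Hom D.obj₁.as D.obj₃.as 1) (p : Hom D.obj₃.as D.obj₁.as (-1))
      (q : Hom D.obj₃.as D.obj₂.as 0) (h : ConeData D.mor₁.1 D.obj₃.as D.mor₂.1 u p q),
      D = Triangle.mk D.mor₁ D.mor₂ h.toShift := by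
  obtain ⟨u, h, p, hp₁, hp₂, h₃⟩ := hD
  obtain ⟨p', q, h'⟩ := h.exists_coneData
  obtain rfl : p = p' := h.hom_ext (fun x => by rw [act_act hp₁, h'.act_p_inl, act_zero])
    (fun x => by
      rw [neg_eq_iff_eq_neg] at hp₂
      rw [act_act hp₂, h'.act_p_inr, act_neg, act_one])
  refine ⟨u, p, q, h', ?_⟩
  obtain ⟨X, Y, C, f, i, k⟩ := D
  refine congr(Triangle.mk f i $(?_))
  exact ZCat.hom_ext h₃

/-- A morphism of triangles in the cycle category up to homotopy whose components are homotopy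
equivalences induces an isomorphism of triangles in the homology category. -/
lemma nonempty_iso_mapTriangle {X Y Z X' Y' Z' : ZCat B} {f : X ⟶ Y} {g : Y ⟶ Z}
    {h : Z ⟶ X⟦(1 : ℤ)⟧} {f' : X' ⟶ Y'} {g' : Y' ⟶ Z'} {h' : Z' ⟶ X'⟦(1 : ℤ)⟧}
    (a : X ⟶ X') (b : Y ⟶ Y') (c : Z ⟶ Z') (ha : IsIso ((toH B).map a))
    (hb : IsIso ((toH B).map b)) (hc : IsIso ((toH B).map c))
    (h₁ : (toH B).map (f ≫ b) = (toH B).map (a ≫ f'))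
    (h₂ : (toH B).map (g ≫ c) = (toH B).map (b ≫ g'))
    (h₃ : (toH B).map (h ≫ a⟦(1 : ℤ)⟧') = (toH B).map (c ≫ h')) :
    Nonempty ((toH B).mapTriangle.obj (Triangle.mk f g h) ≅
      (toH B).mapTriangle.obj (Triangle.mk f' g' h')) := by
  let ea : (toH B).obj X ≅ (toH B).obj X' := asIso ((toH B).map a)
  let eb : (toH B).obj Y ≅ (toH B).obj Y' := asIso ((toH B).map b)
  let ec : (toH B).obj Z ≅ (toH B).obj Z' := asIso ((toH B).map c)
  refine ⟨Triangle.isoMk _ _ ea eb ec ?_ ?_ ?_⟩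
  · exact ((toH B).map_comp _ _).symm.trans (h₁.trans ((toH B).map_comp _ _))
  · exact ((toH B).map_comp _ _).symm.trans (h₂.trans ((toH B).map_comp _ _))
  · have := (toH B).commShiftIso_hom_naturality a (1 : ℤ)
    simp only [Functor.map_comp] at h₃
    change ((toH B).map h ≫ ((toH B).commShiftIso (1 : ℤ)).hom.app X) ≫
      ((toH B).map a)⟦(1 : ℤ)⟧' =
      (toH B).map c ≫ (toH B).map h' ≫ ((toH B).commShiftIso (1 : ℤ)).hom.app X'
    rw [Category.assoc, ← this, reassoc_of% h₃]

lemma distTriangles_of_iso {D D' : Triangle (HCat B)} (h : D' ∈ distTriangles B) (e : D ≅ D') :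
    D ∈ distTriangles B := by
  obtain ⟨K, hK, ⟨e'⟩⟩ := h
  exact ⟨K, hK, ⟨e ≪≫ e'⟩⟩

lemma ConeData.mapTriangle_mem {X Y C : ZCat B} {f : X ⟶ Y} {i : Y ⟶ C}
    {u : Hom X.as C.as 1} {p : Hom C.as X.as (-1)} {q : Hom C.as Y.as 0}
    (h : ConeData f.1 C.as i.1 u p q) :
    (toH B).mapTriangle.obj (Triangle.mk f i h.toShift) ∈ distTriangles B :=
  ⟨_, h.isConeTriangle, ⟨Iso.refl _⟩⟩

/-- A triangle that is homotopy equivalent to a mapping cone triangle induces a distinguished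
triangle. -/
lemma ConeData.mem_distTriangles {X Y Z C : ZCat B} {f : X ⟶ Y} {i : Y ⟶ C}
    {u : Hom X.as C.as 1} {p : Hom C.as X.as (-1)} {q : Hom C.as Y.as 0}
    (h : ConeData f.1 C.as i.1 u p q) {g : Y ⟶ Z} {k : Z ⟶ X⟦(1 : ℤ)⟧} (c : C ⟶ Z) (c' : Z ⟶ C)
    (hc : ∀ x, act c.1 (act c'.1 x) = x) (H : Hom C.as C.as 1)
    (hH : ∀ x, act c'.1 (act c.1 x) - x = eltD _ (act H x) + act H (eltD _ x))
    (hg : ∀ x, act c.1 (act i.1 x) = act g.1 x) (M : Hom C.as (X⟦(1 : ℤ)⟧).as 1)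
    (hM : ∀ x, act (sElt X 1) (act p x) - act k.1 (act c.1 x) =
      eltD _ (act M x) + act M (eltD _ x)) :
    (toH B).mapTriangle.obj (Triangle.mk f g k) ∈ distTriangles B := by
  have : IsIso ((toH B).map c) := by
    refine ⟨(toH B).map c', ?_, ?_⟩
    · rw [← Functor.map_comp, ← (toH B).map_id]
      exact toH_map_eq H (fun x => by rw [ZCat.act_comp_val, ZCat.act_id_val, hH])
    · rw [← Functor.map_comp, ← (toH B).map_id]
      congr 1
      exact ZCat.hom_ext_act (fun x => by rw [ZCat.act_comp_val, ZCat.act_id_val, hc])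
  -- The comparison is the identity on X and Y. The first two squares commute strictly, and only the
  -- third needs the homotopy M.
  obtain ⟨e⟩ := nonempty_iso_mapTriangle (h := h.toShift) (h' := k) (f := f) (f' := f) (g := i)
    (g' := g) (𝟙 X) (𝟙 Y) c (by rw [CategoryTheory.Functor.map_id]; infer_instance)
    (by rw [CategoryTheory.Functor.map_id]; infer_instance) this (by simp) (by
      rw [Category.id_comp]
      congr 1
      exact ZCat.hom_ext_act (fun x => by rw [ZCat.act_comp_val, hg])) (by
      rw [CategoryTheory.Functor.map_id, Category.comp_id]
      exact toH_map_eq M (fun x => by rw [ZCat.act_comp_val, ← hM x, ← h.act_toShift]))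
  exact distTriangles_of_iso h.mapTriangle_mem e.symm

lemma exists_distTriangle {X Y : HCat B} (f : X ⟶ Y) : ∃ (Z : HCat B) (g : Y ⟶ Z)
    (h : Z ⟶ X⟦(1 : ℤ)⟧), Triangle.mk f g h ∈ distTriangles B := by
  obtain ⟨f, rfl⟩ := (toH B).map_surjective (X := X.as) (Y := Y.as) f
  obtain ⟨C, i, u, p, q, h⟩ := exists_coneData f
  exact ⟨_, _, _, h.mapTriangle_mem⟩

lemma contractible_mem_distTriangles (X : HCat B) : contractibleTriangle X ∈ distTriangles B := by
  obtain ⟨C, i, u, p, q, h⟩ := exists_coneData (𝟙 X.as)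
  have hC : IsZero ((toH B).obj C) := by
    rw [IsZero.iff_id_eq_zero, ← (toH B).map_id, ← (toH B).map_zero]
    -- The cone of an identity is contracted by u q: since d(u q) = i q - u p = 1, the object
    -- becomes zero in homology.
    refine toH_map_eq (castDeg (by lia) (cmul u q)) (fun x => ?_)
    rw [ZCat.act_id_val]
    erw [act_zero]
    simp only [act_castDeg, act_cmul, h.eltD_inr, h.eltD_q, ZCat.act_id_val, h.act_inl_q, map_add]
    abel
  refine distTriangles_of_iso h.mapTriangle_mem ?_
  refine Triangle.isoMk _ _ (Iso.refl _) (Iso.refl _) ((isZero_zero _).iso hC) ?_ ?_ ?_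
  · simp
    rfl
  · exact hC.eq_of_tgt _ _
  · exact (isZero_zero _).eq_of_src _ _

end Pretriangulated

/-! ### Rotation, morphisms of triangles and the octahedral axiom -/

section Rotation

variable {B : Type u} [DGCategory.{v} B] [IsPretriangulated B]

/-- The cone of i : Y ⟶ C is built from Y, X[1] and Y[1]. The two copies of Y cancel, leaving X[1];
the homotopy -w q Q carries the Y inside C to the other copy. -/
lemma ConeData.rotate_mem {X Y C : ZCat B} {f : X ⟶ Y} {i : Y ⟶ C}
    {u : Hom X.as C.as 1} {p : Hom C.as X.as (-1)} {q : Hom C.as Y.as 0}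
    (h : ConeData f.1 C.as i.1 u p q) :
    (toH B).mapTriangle.obj (Triangle.mk i h.toShift (-f⟦(1 : ℤ)⟧')) ∈ distTriangles B := by
  obtain ⟨C', j, w, P, Q, h'⟩ := exists_coneData i
  refine h'.mem_distTriangles
    (zmk (castDeg (by lia) (cmul (sElt X 1) (cmul p Q))) (fun x => ?_))
    (zmk (castDeg (by lia) (cmul (cmul w f.1 - castDeg (by lia) (cmul j.1 u)) (tElt X 1)))
      (fun x => ?_))
    (fun x => ?_) (-castDeg (by lia) (cmul w (cmul q Q))) (fun x => ?_) (fun x => ?_)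
    (-castDeg (by lia) (cmul (sElt Y 1) (cmul q Q))) (fun x => ?_) <;>
  simp only [zmk_val, act_castDeg, act_cmul, act_sub, act_neg, ZCat.act_neg_val, act_shift_map,
    map_sub, map_neg, map_add, map_zero, eltD_act_sElt_one, eltD_act_tElt_one, act_sElt_tElt,
    act_tElt_sElt, ZCat.eltD_act,
    h.eltD_inr, h.eltD_p, h.eltD_q, h.act_p_inl, h.act_p_inr, h.act_q_inl,
    h.act_inl_q, h'.eltD_inr, h'.eltD_q, h'.act_q_inl,
    h'.act_q_inr, h'.act_inl_q, h.act_toShift] <;> try abel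

/-- The cone of C[-1] ⟶ X is built from X and C, and C from Y and X[1]. Here the two copies of X
cancel, leaving Y; the homotopy sends X through u into C. -/
lemma ConeData.invRotate_mem {X Y C : ZCat B} {f : X ⟶ Y} {i : Y ⟶ C}
    {u : Hom X.as C.as 1} {p : Hom C.as X.as (-1)} {q : Hom C.as Y.as 0}
    (h : ConeData f.1 C.as i.1 u p q) :
    (toH B).mapTriangle.obj (Triangle.mk f i h.toShift).invRotate ∈ distTriangles B := by
  -- G and K are the outer morphisms of the inverse rotation, with the unit and counit of the shift
  -- equivalence resolved into universal cycles.
  obtain ⟨G, hG, hG'⟩ : ∃ G : C⟦(-1 : ℤ)⟧ ⟶ X,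
      -h.toShift⟦(-1 : ℤ)⟧' ≫ (shiftEquiv (ZCat B) (1 : ℤ)).unitIso.inv.app X = G ∧
      ∀ x, act G.1 x = -act p (act (tElt C (-1)) x) :=
    ⟨_, rfl, fun x => by
      refine (ZCat.act_neg_val _ _).trans (congrArg Neg.neg ?_)
      refine (ZCat.act_comp_val (h.toShift⟦(-1 : ℤ)⟧')
        ((shiftFunctorCompIsoId (ZCat B) 1 (-1) (by lia)).hom.app X) _).trans ?_
      rw [act_shift_map, h.act_toShift]
      refine (act_shiftFunctorCompIsoId_hom X 1 (-1) (by lia) _).trans ?_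
      rw [act_tElt_sElt, act_tElt_sElt]⟩
  obtain ⟨K, hK, hK'⟩ : ∃ K : Y ⟶ C⟦(-1 : ℤ)⟧⟦(1 : ℤ)⟧,
      i ≫ (shiftEquiv (ZCat B) (1 : ℤ)).counitIso.inv.app C = K ∧
      ∀ x, act K.1 x = act (sElt (C⟦(-1 : ℤ)⟧) 1) (act (sElt C (-1)) (act i.1 x)) :=
    ⟨_, rfl, fun x => by
      refine (ZCat.act_comp_val _ _ _).trans ?_
      exact act_shiftFunctorCompIsoId_inv C (-1) 1 (by lia) _⟩
  have e : (Triangle.mk f i h.toShift).invRotate = Triangle.mk G f K := by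
    rw [← hG, ← hK]
    rfl
  rw [e]
  obtain ⟨D, j, w, P, Q, h'⟩ := exists_coneData G
  refine h'.mem_distTriangles
    (zmk (cmul f.1 Q + castDeg (by lia) (cmul q (cmul (tElt C (-1)) P))) (fun x => ?_))
    (zmk (-castDeg (by lia) (cmul w (cmul (sElt C (-1)) i.1))) (fun x => ?_))
    (fun x => ?_) (-castDeg (by lia) (cmul w (cmul (sElt C (-1)) (cmul u Q)))) (fun x => ?_)
    (fun x => ?_)
    (-castDeg (by lia) (cmul (sElt (C⟦(-1 : ℤ)⟧) 1) (cmul (sElt C (-1)) (cmul u Q))))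
    (fun x => ?_) <;>
  simp only [zmk_val, act_castDeg, act_cmul, act_add, act_neg,
    map_sub, map_neg, map_add, map_zero, eltD_act_sElt_one, eltD_act_sElt_neg_one,
    eltD_act_tElt_neg_one, act_sElt_tElt, act_tElt_sElt, ZCat.eltD_act, hG', hK',
    h.eltD_inr, h.eltD_q, h.act_p_inl, h.act_p_inr, h.act_q_inl,
    h.act_inl_q, h'.eltD_inr, h'.eltD_p, h'.eltD_q, h'.act_p_inl, h'.act_p_inr, h'.act_q_inl,
    h'.act_q_inr, h'.act_inl_q] <;> try abel

lemma exists_coneData_of_mem_distTriangles {D : Triangle (HCat B)} (hD : D ∈ distTriangles B) :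
    ∃ (X Y C : ZCat B) (f : X ⟶ Y) (i : Y ⟶ C) (u : Hom X.as C.as 1) (p : Hom C.as X.as (-1))
      (q : Hom C.as Y.as 0) (h : ConeData f.1 C.as i.1 u p q),
      Nonempty (D ≅ (toH B).mapTriangle.obj (Triangle.mk f i h.toShift)) := by
  obtain ⟨D', hD', ⟨e⟩⟩ := hD
  obtain ⟨u, p, q, h, hD'⟩ := hD'.exists_coneData
  exact ⟨_, _, _, _, _, u, p, q, h, ⟨e ≪≫ (toH B).mapTriangle.mapIso (eqToIso hD')⟩⟩

lemma rotate_mem_distTriangles {D : Triangle (HCat B)} (hD : D ∈ distTriangles B) :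
    D.rotate ∈ distTriangles B := by
  obtain ⟨_, _, _, _, _, _, _, _, h, ⟨e⟩⟩ := exists_coneData_of_mem_distTriangles hD
  exact distTriangles_of_iso h.rotate_mem ((rotate _).mapIso e ≪≫
    (toH B).mapTriangleRotateIso.app _)

lemma invRotate_mem_distTriangles {D : Triangle (HCat B)} (hD : D ∈ distTriangles B) :
    D.invRotate ∈ distTriangles B := by
  obtain ⟨_, _, _, _, _, _, _, _, h, ⟨e⟩⟩ := exists_coneData_of_mem_distTriangles hD
  exact distTriangles_of_iso h.invRotate_mem ((invRotate _).mapIso e ≪≫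
    (toH B).mapTriangleInvRotateIso.app _)

/-- The map of cones is b on Y and a on X[1], where the minus sign of u' a p makes up for p u = -1.
The term -i' H p corrects for the square commuting only up to the homotopy H. The other two squares
then commute strictly. -/
lemma exists_mapTriangle_hom {X Y C X' Y' C' : ZCat B} {f : X ⟶ Y} {i : Y ⟶ C}
    {u : Hom X.as C.as 1} {p : Hom C.as X.as (-1)} {q : Hom C.as Y.as 0}
    (h : ConeData f.1 C.as i.1 u p q) {f' : X' ⟶ Y'} {i' : Y' ⟶ C'}
    {u' : Hom X'.as C'.as 1} {p' : Hom C'.as X'.as (-1)} {q' : Hom C'.as Y'.as 0}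
    (h' : ConeData f'.1 C'.as i'.1 u' p' q') (a : X ⟶ X') (b : Y ⟶ Y')
    (hab : (toH B).map (f ≫ b) = (toH B).map (a ≫ f')) :
    ∃ c : C ⟶ C', i ≫ c = b ≫ i' ∧ h.toShift ≫ a⟦(1 : ℤ)⟧' = c ≫ h'.toShift := by
  obtain ⟨H, hH⟩ := exists_homotopy hab
  simp only [ZCat.act_comp_val] at hH
  refine ⟨zmk (castDeg (by lia) (cmul i'.1 (cmul b.1 q)) -
    castDeg (by lia) (cmul u' (cmul a.1 p)) - castDeg (by lia) (cmul i'.1 (cmul H p)))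
    (fun x => ?_), ZCat.hom_ext_act (fun x => ?_), ZCat.hom_ext_act (fun x => ?_)⟩ <;>
  simp only [zmk_val, act_castDeg, act_cmul, act_sub, ZCat.act_comp_val, act_shift_map,
    map_sub, map_neg, map_add, map_zero, act_tElt_sElt, ZCat.eltD_act, hH,
    h.eltD_p, h.eltD_q, h.act_p_inl, h.act_q_inl, h.act_toShift, h'.act_toShift,
    h'.eltD_inr, h'.act_p_inl, h'.act_p_inr] <;> try abel

lemma exists_iso_of_mem_distTriangles {D : Triangle (HCat B)} (hD : D ∈ distTriangles B) :
    ∃ (X Y C : ZCat B) (f : X ⟶ Y) (i : Y ⟶ C) (u : Hom X.as C.as 1) (p : Hom C.as X.as (-1))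
      (q : Hom C.as Y.as 0) (h : ConeData f.1 C.as i.1 u p q) (e₁ : D.obj₁ ≅ (toH B).obj X)
      (e₂ : D.obj₂ ≅ (toH B).obj Y) (e₃ : D.obj₃ ≅ (toH B).obj C),
      D.mor₁ ≫ e₂.hom = e₁.hom ≫ (toH B).map f ∧ D.mor₂ ≫ e₃.hom = e₂.hom ≫ (toH B).map i ∧
      D.mor₃ ≫ e₁.hom⟦(1 : ℤ)⟧' =
        e₃.hom ≫ (toH B).map h.toShift ≫ ((toH B).commShiftIso (1 : ℤ)).hom.app X := by
  obtain ⟨X, Y, C, f, i, u, p, q, h, ⟨e⟩⟩ := exists_coneData_of_mem_distTriangles hD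
  exact ⟨X, Y, C, f, i, u, p, q, h, Triangle.π₁.mapIso e, Triangle.π₂.mapIso e,
    Triangle.π₃.mapIso e, e.hom.comm₁, e.hom.comm₂, e.hom.comm₃⟩

/-- Replace both triangles by cone triangles and lift a and b to closed morphisms; the lifted square
commutes up to homotopy, which is what the strict lemma needs. -/
lemma complete_distTriangles_morphism (D D' : Triangle (HCat B)) (h : D ∈ distTriangles B)
    (h' : D' ∈ distTriangles B) (a : D.obj₁ ⟶ D'.obj₁) (b : D.obj₂ ⟶ D'.obj₂)
    (hab : D.mor₁ ≫ b = a ≫ D'.mor₁) :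
    ∃ c : D.obj₃ ⟶ D'.obj₃, D.mor₂ ≫ c = b ≫ D'.mor₂ ∧
      D.mor₃ ≫ a⟦(1 : ℤ)⟧' = c ≫ D'.mor₃ := by
  obtain ⟨X, Y, C, f, i, u, p, q, h, e₁, e₂, e₃, hf, hi, hk⟩ := exists_iso_of_mem_distTriangles h
  obtain ⟨X', Y', C', f', i', u', p', q', h', e₁', e₂', e₃', hf', hi', hk'⟩ :=
    exists_iso_of_mem_distTriangles h'
  obtain ⟨a', ha'⟩ : ∃ a' : X ⟶ X', (toH B).map a' = e₁.inv ≫ a ≫ e₁'.hom :=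
    (toH B).map_surjective _
  obtain ⟨b', hb'⟩ : ∃ b' : Y ⟶ Y', (toH B).map b' = e₂.inv ≫ b ≫ e₂'.hom :=
    (toH B).map_surjective _
  obtain ⟨c, hc, hc'⟩ := exists_mapTriangle_hom h h' a' b' (by
    rw [Functor.map_comp, Functor.map_comp, ha', hb', ← cancel_epi e₁.hom, ← reassoc_of% hf,
      Iso.hom_inv_id_assoc, reassoc_of% hab, hf']
    simp)
  replace hc := congr((toH B).map $hc)
  replace hc' := congr((toH B).map $hc')
  have hs := (toH B).commShiftIso_hom_naturality a' (1 : ℤ)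
  rw [Functor.map_comp, Functor.map_comp] at hc hc'
  refine ⟨e₃.hom ≫ (toH B).map c ≫ e₃'.inv, ?_, ?_⟩
  · rw [reassoc_of% hi, reassoc_of% hc, hb', ← cancel_mono e₃'.hom]
    simp [hi']
  · rw [← cancel_mono (e₁'.hom⟦(1 : ℤ)⟧'), Category.assoc, Category.assoc, Category.assoc,
      Category.assoc, hk', Iso.inv_hom_id_assoc, ← reassoc_of% hc', hs, ← reassoc_of% hk,
      ← Functor.map_comp, ← Functor.map_comp, ha', Iso.hom_inv_id_assoc]

/-- The cone of m₁ : C₁ ⟶ C₃ is built from Z, X[1], Y[1] and X[2]. The two shifts of X cancel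
through the homotopy w u₁ p₃ Q, leaving Z and Y[1], that is, C₂. -/
lemma octahedron_mem {X Y Z C₁ C₂ C₃ : ZCat B} {f : X ⟶ Y} {g : Y ⟶ Z} {i₁ : Y ⟶ C₁}
    {u₁ : Hom X.as C₁.as 1} {p₁ : Hom C₁.as X.as (-1)} {q₁ : Hom C₁.as Y.as 0}
    (h₁ : ConeData f.1 C₁.as i₁.1 u₁ p₁ q₁) {i₂ : Z ⟶ C₂}
    {u₂ : Hom Y.as C₂.as 1} {p₂ : Hom C₂.as Y.as (-1)} {q₂ : Hom C₂.as Z.as 0}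
    (h₂ : ConeData g.1 C₂.as i₂.1 u₂ p₂ q₂) {i₃ : Z ⟶ C₃}
    {u₃ : Hom X.as C₃.as 1} {p₃ : Hom C₃.as X.as (-1)} {q₃ : Hom C₃.as Z.as 0}
    (h₃ : ConeData (f ≫ g).1 C₃.as i₃.1 u₃ p₃ q₃) :
    ∃ (m₁ : C₁ ⟶ C₃) (m₃ : C₃ ⟶ C₂), i₁ ≫ m₁ = g ≫ i₃ ∧ m₁ ≫ h₃.toShift = h₁.toShift ∧
      i₃ ≫ m₃ = i₂ ∧ m₃ ≫ h₂.toShift = h₃.toShift ≫ f⟦(1 : ℤ)⟧' ∧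
      (toH B).mapTriangle.obj (Triangle.mk m₁ m₃ (h₂.toShift ≫ i₁⟦(1 : ℤ)⟧')) ∈
        distTriangles B := by
  obtain ⟨m₁, hm₁⟩ : ∃ m₁ : C₁ ⟶ C₃, ∀ x, act m₁.1 x =
      act i₃.1 (act g.1 (act q₁ x)) - act u₃ (act p₁ x) :=
    ⟨zmk (castDeg (by lia) (cmul i₃.1 (cmul g.1 q₁)) - castDeg (by lia) (cmul u₃ p₁)) (fun x => by
      simp only [act_castDeg, act_cmul, act_sub, map_sub, map_neg, map_add, ZCat.eltD_act,
        h₁.eltD_p, h₁.eltD_q, h₃.eltD_inr, ZCat.act_comp_val]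
      abel), fun x => by simp only [zmk_val, act_castDeg, act_cmul, act_sub]⟩
  obtain ⟨m₃, hm₃⟩ : ∃ m₃ : C₃ ⟶ C₂, ∀ x, act m₃.1 x =
      act i₂.1 (act q₃ x) - act u₂ (act f.1 (act p₃ x)) :=
    ⟨zmk (castDeg (by lia) (cmul i₂.1 q₃) - castDeg (by lia) (cmul u₂ (cmul f.1 p₃))) (fun x => by
      simp only [act_castDeg, act_cmul, act_sub, map_sub, map_neg, map_add, ZCat.eltD_act,
        h₃.eltD_p, h₃.eltD_q, h₂.eltD_inr, ZCat.act_comp_val]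
      abel), fun x => by simp only [zmk_val, act_castDeg, act_cmul, act_sub]⟩
  refine ⟨m₁, m₃, ZCat.hom_ext_act (fun x => ?_), ZCat.hom_ext_act (fun x => ?_),
    ZCat.hom_ext_act (fun x => ?_), ZCat.hom_ext_act (fun x => ?_), ?_⟩
  · simp only [ZCat.act_comp_val, hm₁, h₁.act_q_inl, h₁.act_p_inl, map_zero, sub_zero]
  · simp only [ZCat.act_comp_val, hm₁, h₃.act_toShift, h₁.act_toShift, map_sub, h₃.act_p_inl,
      h₃.act_p_inr, zero_sub, neg_neg]
  · simp only [ZCat.act_comp_val, hm₃, h₃.act_q_inl, h₃.act_p_inl, map_zero, sub_zero]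
  · simp only [ZCat.act_comp_val, hm₃, h₃.act_toShift, h₂.act_toShift, map_sub, h₂.act_p_inl,
      h₂.act_p_inr, zero_sub, neg_neg, act_shift_map, act_tElt_sElt]
  · obtain ⟨K, j, w, P, Q, h'⟩ := exists_coneData m₁
    refine h'.mem_distTriangles
      (zmk (cmul m₃.1 Q - castDeg (by lia) (cmul u₂ (cmul q₁ P))) (fun x => ?_))
      (zmk (castDeg (by lia) (cmul j.1 (cmul i₃.1 q₂)) - castDeg (by lia) (cmul w (cmul i₁.1 p₂)))
        (fun x => ?_))
      (fun x => ?_) (castDeg (by lia) (cmul w (cmul u₁ (cmul p₃ Q)))) (fun x => ?_) (fun x => ?_)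
      (castDeg (by lia) (cmul (sElt C₁ 1) (cmul u₁ (cmul p₃ Q)))) (fun x => ?_) <;>
    simp only [zmk_val, act_castDeg, act_cmul, act_sub,
      map_sub, map_neg, map_add, map_zero, eltD_act_sElt_one, ZCat.act_comp_val, act_shift_map,
      act_tElt_sElt, ZCat.eltD_act, hm₁, hm₃, h₂.act_toShift,
      h₁.eltD_inr, h₁.eltD_q, h₁.act_p_inl, h₁.act_p_inr, h₁.act_q_inl, h₁.act_q_inr,
      h₁.act_inl_q, h₂.eltD_inr, h₂.eltD_p, h₂.eltD_q, h₂.act_p_inl, h₂.act_p_inr, h₂.act_q_inl,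
      h₂.act_q_inr, h₂.act_inl_q, h₃.eltD_p, h₃.eltD_q, h₃.act_p_inl, h₃.act_p_inr,
      h₃.act_q_inl, h₃.act_q_inr, h₃.act_inl_q,
      h'.eltD_inr, h'.eltD_p, h'.eltD_q, h'.act_p_inl, h'.act_p_inr, h'.act_q_inl,
      h'.act_q_inr, h'.act_inl_q] <;> try abel

variable (B) in
/-- The homology category of a pretriangulated dg category is pretriangulated. -/
noncomputable abbrev pretriangulatedHCat : Pretriangulated (HCat B) where
  distinguishedTriangles := distTriangles B
  isomorphic_distinguished _ h _ e := distTriangles_of_iso h e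
  contractible_distinguished := contractible_mem_distTriangles
  distinguished_cocone_triangle := exists_distTriangle
  rotate_distinguished_triangle D :=
    ⟨rotate_mem_distTriangles, fun h => distTriangles_of_iso (invRotate_mem_distTriangles h)
      (rotCompInvRot.app D)⟩
  complete_distinguished_triangle_morphism := complete_distTriangles_morphism

variable (B) in
/-- The homology category of a pretriangulated dg category is triangulated. -/
lemma isTriangulated_hCat : @IsTriangulated (HCat B) _ _ _ _ _ (pretriangulatedHCat B) := by
  let := pretriangulatedHCat B
  -- An octahedron is needed for one choice of cones only, so standard cones of representing cycles
  -- suffice, with the composite taken in the cycle category.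
  refine IsTriangulated.mk' (fun X Y Z f g => ?_)
  obtain ⟨f, rfl⟩ := (toH B).map_surjective (X := X.as) (Y := Y.as) f
  obtain ⟨g, rfl⟩ := (toH B).map_surjective (X := Y.as) (Y := Z.as) g
  obtain ⟨C₁, i₁, u₁, p₁, q₁, h₁⟩ := exists_coneData f
  obtain ⟨C₂, i₂, u₂, p₂, q₂, h₂⟩ := exists_coneData g
  obtain ⟨C₃, i₃, u₃, p₃, q₃, h₃⟩ := exists_coneData (f ≫ g)
  obtain ⟨m₁, m₃, e₁, e₂, e₃, e₄, hm⟩ := octahedron_mem h₁ h₂ h₃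
  refine ⟨_, _, _, (toH B).obj C₁, (toH B).obj C₂, (toH B).obj C₃, (toH B).map f, (toH B).map g,
    Iso.refl _, Iso.refl _, Iso.refl _, by simp, by simp, _, _, h₁.mapTriangle_mem,
    _, _, h₂.mapTriangle_mem, (toH B).map i₃,
    (toH B).map h₃.toShift ≫ ((toH B).commShiftIso (1 : ℤ)).hom.app X.as, ?_,
    ⟨(toH B).map m₁, (toH B).map m₃, ?_, ?_, ?_, ?_, ?_⟩⟩
  · rw [← Functor.map_comp]
    exact h₃.mapTriangle_mem
  · exact ((toH B).map_comp _ _).symm.trans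
      ((congrArg (toH B).map e₁).trans ((toH B).map_comp _ _))
  · refine (Category.assoc _ _ _).symm.trans (congrArg (· ≫ _) ?_)
    exact ((toH B).map_comp _ _).symm.trans (congrArg (toH B).map e₂)
  · exact ((toH B).map_comp _ _).symm.trans (congrArg (toH B).map e₃)
  · change ((toH B).map h₃.toShift ≫ ((toH B).commShiftIso (1 : ℤ)).hom.app X.as) ≫
      ((toH B).map f)⟦(1 : ℤ)⟧' =
        (toH B).map m₃ ≫ (toH B).map h₂.toShift ≫ ((toH B).commShiftIso (1 : ℤ)).hom.app Y.as
    rw [Category.assoc, ← (toH B).commShiftIso_hom_naturality f (1 : ℤ), ← Functor.map_comp_assoc,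
      ← e₄, Functor.map_comp_assoc]
  · have e : ((toH B).map h₂.toShift ≫ ((toH B).commShiftIso (1 : ℤ)).hom.app Y.as) ≫
        ((toH B).map i₁)⟦(1 : ℤ)⟧' = (toH B).map (h₂.toShift ≫ i₁⟦(1 : ℤ)⟧') ≫
          ((toH B).commShiftIso (1 : ℤ)).hom.app C₁ := by
      rw [Category.assoc, ← (toH B).commShiftIso_hom_naturality i₁ (1 : ℤ), Functor.map_comp,
        Category.assoc]
    exact (congrArg (fun k => Triangle.mk ((toH B).map m₁) ((toH B).map m₃) k ∈ distTriangles B)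
      e).mpr hm

end Rotation

/-! ### Dg functors induce exact functors -/

namespace DGFunctor

section

variable {B : Type u} [DGCategory.{v} B] {C : Type u'} [DGCategory.{v'} C] (F : DGFunctor B C)

lemma map_castDeg {X Y : B} {i j : ℤ} (h : i = j) (φ : Hom X Y i) :
    F.map (castDeg h φ) = castDeg h (F.map φ) := by
  subst h; rfl

lemma map_cmul {X Y Z : B} {i j : ℤ} (φ : Hom Y Z i) (ψ : Hom X Y j) :
    F.map (cmul φ ψ) = cmul (F.map φ) (F.map ψ) := F.map_comp _ _ _

lemma act_map_act_map {X Y Z : B} {i j k : ℤ} {h : i + j = k} {φ : Hom Y Z i} {ψ : Hom X Y j}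
    {χ : Hom X Z k} (e : DGCategory.comp h φ ψ = χ) (x : Elts (F.obj X)) :
    act (F.map φ) (act (F.map ψ) x) = act (F.map χ) x := by
  rw [← e, F.map_comp, act_comp]

/-- Mapping cones are absolute: they are described by equations, which every dg functor preserves.
-/
lemma map_coneData {X Y K : B} {f : Hom X Y 0} {i : Hom Y K 0} {u : Hom X K 1}
    {p : Hom K X (-1)} {q : Hom K Y 0} (h : ConeData f K i u p q) :
    ConeData (F.map f) (F.obj K) (F.map i) (F.map u) (F.map p) (F.map q) where
  d_inl := by rw [← F.map_d, h.d_inl, map_zero]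
  d_inr := by rw [← F.map_d, h.d_inr, F.map_comp]
  p_inl := by rw [← F.map_comp, h.p_inl, map_zero]
  p_inr := by rw [← F.map_comp, h.p_inr, map_neg, F.map_one]
  q_inl := by rw [← F.map_comp, h.q_inl, F.map_one]
  q_inr := by rw [← F.map_comp, h.q_inr, map_zero]
  total := by rw [← F.map_comp, h.total, map_add, F.map_comp, F.map_one]

end

section

variable {B : Type u} [DGCategory.{v} B] [IsPretriangulated B] {C : Type u'} [DGCategory.{v'} C]
  (F : DGFunctor B C)

lemma act_map_sElt_tElt (X : ZCat B) (a : ℤ) (x : Elts (F.obj (X⟦a⟧).as)) :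
    act (F.map (sElt X a)) (act (F.map (tElt X a)) x) = x := by
  have e : DGCategory.comp (add_neg_cancel a) (sElt X a) (tElt X a) = one _ :=
    act_injective (fun x => by rw [act_comp, act_sElt_tElt, act_one])
  rw [F.act_map_act_map e, F.map_one, act_one]

lemma act_map_tElt_sElt (X : ZCat B) (a : ℤ) (x : Elts (F.obj X.as)) :
    act (F.map (tElt X a)) (act (F.map (sElt X a)) x) = x := by
  have e : DGCategory.comp (neg_add_cancel a) (tElt X a) (sElt X a) = one _ :=
    act_injective (fun x => by rw [act_comp, act_tElt_sElt, act_one])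
  rw [F.act_map_act_map e, F.map_one, act_one]

lemma act_map_shift_map {X Y : ZCat B} (f : X ⟶ Y) (a : ℤ) (x : Elts (F.obj (X⟦a⟧).as)) :
    act (F.map (f⟦a⟧').1) x =
      act (F.map (sElt Y a)) (act (F.map f.1) (act (F.map (tElt X a)) x)) := by
  have e : (f⟦a⟧').1 = castDeg (by lia) (cmul (sElt Y a) (cmul f.1 (tElt X a))) :=
    act_injective (fun x => by rw [act_shift_map, act_castDeg, act_cmul, act_cmul])
  rw [e, map_castDeg, act_castDeg, map_cmul, map_cmul, act_cmul, act_cmul]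

lemma act_map_shiftFunctorZero_hom (X : ZCat B) (x : Elts (F.obj (X⟦(0 : ℤ)⟧).as)) :
    act (F.map (Y := X.as) ((shiftFunctorZero (ZCat B) ℤ).hom.app X).1) x =
      act (F.map (tElt X 0)) x := by
  have e : ((shiftFunctorZero (ZCat B) ℤ).hom.app X).1 = castDeg (by lia) (tElt X 0) :=
    act_injective (fun x => (act_shiftFunctorZero_hom X x).trans (act_castDeg _ _ _).symm)
  exact congr(act (F.map $e) x).trans (by rw [map_castDeg, act_castDeg])

lemma act_map_shiftFunctorAdd_hom (X : ZCat B) (a b : ℤ) (x : Elts (F.obj (X⟦a + b⟧).as)) :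
    act (F.map (Y := (X⟦a⟧⟦b⟧).as) ((shiftFunctorAdd (ZCat B) a b).hom.app X).1) x =
      act (F.map (sElt (X⟦a⟧) b)) (act (F.map (sElt X a)) (act (F.map (tElt X (a + b))) x)) := by
  have e : ((shiftFunctorAdd (ZCat B) a b).hom.app X).1 =
      castDeg (by lia) (cmul (sElt (X⟦a⟧) b) (cmul (sElt X a) (tElt X (a + b)))) :=
    act_injective (fun x => (act_shiftFunctorAdd_hom X a b x).trans (by
      rw [act_castDeg, act_cmul, act_cmul]))
  exact congr(act (F.map $e) x).trans (by
    rw [map_castDeg, act_castDeg, map_cmul, map_cmul, act_cmul, act_cmul])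

variable [IsPretriangulated C]

/-- The canonical isomorphism `F(X[a]) ≅ F(X)[a]` for a dg functor `F`. -/
noncomputable def shiftIso (a : ℤ) (X : ZCat B) :
    F.mapZ.obj (X⟦a⟧) ≅ (F.mapZ.obj X)⟦a⟧ where
  hom := ⟨DGCategory.comp (add_neg_cancel a) (sElt (F.mapZ.obj X) a) (F.map (tElt X a)),
    mem_cycles.2 (d_comp_eq_zero _ _ _ _ (isShift_sElt _ a).d_eq
      ((F.map_d _ _).symm.trans (by rw [d_tElt, map_zero]; rfl)))⟩
  inv := ⟨DGCategory.comp (add_neg_cancel a) (F.map (sElt X a)) (tElt (F.mapZ.obj X) a),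
    mem_cycles.2 (d_comp_eq_zero _ _ _ _
      ((F.map_d _ _).symm.trans (by rw [(isShift_sElt X a).d_eq, map_zero]; rfl))
      (d_tElt _ a))⟩
  hom_inv_id := ZCat.hom_ext_act (fun x => by
    refine (ZCat.act_comp_val _ _ _).trans ?_
    refine congr(act _ $(act_comp _ _ _ _)).trans ((act_comp _ _ _ _).trans ?_)
    refine congr(act (F.map (sElt X a)) $(act_tElt_sElt _ _ _)).trans ?_
    exact (act_map_sElt_tElt F X a x).trans (ZCat.act_id_val _ _).symm)
  inv_hom_id := ZCat.hom_ext_act (fun x => by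
    refine (ZCat.act_comp_val _ _ _).trans ?_
    refine congr(act _ $(act_comp _ _ _ _)).trans ((act_comp _ _ _ _).trans ?_)
    refine congr(act (sElt (F.mapZ.obj X) a) $(act_map_tElt_sElt F _ _ _)).trans ?_
    exact (act_sElt_tElt (F.mapZ.obj X) a x).trans (ZCat.act_id_val _ _).symm)

lemma act_shiftIso_hom (a : ℤ) (X : ZCat B) (x : Elts (F.obj (X⟦a⟧).as)) :
    act (X := F.obj (X⟦a⟧).as) (F.shiftIso a X).hom.1 x =
      act (sElt (F.mapZ.obj X) a) (act (Y := F.obj X.as) (F.map (tElt X a)) x) :=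
  act_comp _ _ _ _

/-- The comparison is s_{FX} · F(t_X). Naturality and the two coherence conditions follow by
cancelling s against t, in the target and under F. -/
noncomputable instance : F.mapZ.CommShift ℤ where
  commShiftIso a := NatIso.ofComponents (fun X => F.shiftIso a X) (fun {X Y} f => by
    refine ZCat.hom_ext_act (fun x => ?_)
    refine (ZCat.act_comp_val _ _ _).trans (Eq.trans ?_ (ZCat.act_comp_val _ _ _).symm)
    refine (act_shiftIso_hom F a Y _).trans (Eq.trans ?_ (act_shift_map _ _ _).symm)
    refine congr(act (sElt (F.mapZ.obj Y) a) (act (F.map (tElt Y a))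
      $(act_map_shift_map F f a x))).trans ?_
    refine congr(act (sElt (F.mapZ.obj Y) a) $(act_map_tElt_sElt F _ _ _)).trans ?_
    refine congr(act (sElt (F.mapZ.obj Y) a) (act (F.map f.1) $(Eq.symm ?_)))
    refine congr(act (tElt (F.mapZ.obj X) a) $(act_shiftIso_hom F a X x)).trans ?_
    exact act_tElt_sElt (F.mapZ.obj X) a _)
  commShiftIso_zero := by
    ext X
    refine ZCat.hom_ext_act (fun x => ?_)
    refine (act_shiftIso_hom F 0 X x).trans ?_
    rw [Functor.CommShift.isoZero_hom_app]
    refine Eq.trans ?_ (ZCat.act_comp_val _ _ _).symm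
    refine Eq.trans ?_ (act_shiftFunctorZero_inv (F.mapZ.obj X) _).symm
    exact congr(act (sElt (F.mapZ.obj X) 0) $(act_map_shiftFunctorZero_hom F X x)).symm
  commShiftIso_add a b := by
    ext X
    refine ZCat.hom_ext_act (fun x => ?_)
    refine (act_shiftIso_hom F (a + b) X x).trans ?_
    rw [Functor.CommShift.isoAdd_hom_app]
    refine Eq.trans ?_ (ZCat.act_comp_val _ _ _).symm
    refine Eq.trans ?_ (ZCat.act_comp_val _ _ _).symm
    refine Eq.trans ?_ (ZCat.act_comp_val _ _ _).symm
    refine Eq.trans ?_ (act_shiftFunctorAdd_inv (F.mapZ.obj X) a b _).symm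
    refine congr(act (sElt (F.mapZ.obj X) (a + b)) $(Eq.symm ?_))
    refine congr(act (tElt (F.mapZ.obj X) a) (act (tElt ((F.mapZ.obj X)⟦a⟧) b)
      $(act_shift_map _ b _))).trans ?_
    refine congr(act (tElt (F.mapZ.obj X) a) $(act_tElt_sElt _ _ _)).trans ?_
    refine congr(act (tElt (F.mapZ.obj X) a) $(act_shiftIso_hom F a X _)).trans ?_
    refine (act_tElt_sElt _ _ _).trans ?_
    refine congr(act (F.map (tElt X a)) (act (tElt (F.mapZ.obj (X⟦a⟧)) b)
      $(act_shiftIso_hom F b (X⟦a⟧) _))).trans ?_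
    refine congr(act (F.map (tElt X a)) $(act_tElt_sElt _ _ _)).trans ?_
    refine congr(act (F.map (tElt X a)) (act (F.map (tElt (X⟦a⟧) b))
      $(act_map_shiftFunctorAdd_hom F X a b x))).trans ?_
    refine congr(act (F.map (tElt X a)) $(act_map_tElt_sElt F (X⟦a⟧) b _)).trans ?_
    exact act_map_tElt_sElt F X a _

noncomputable instance : F.mapH.CommShift ℤ :=
  CategoryTheory.Quotient.liftCommShift (F.mapZ ⋙ toH C) (homologous B) _ _

/-- The isomorphism between the functors `Z(B) ⥤ H(C)` induced by a dg functor. -/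
def toHCompMapH : toH B ⋙ F.mapH ≅ F.mapZ ⋙ toH C :=
  CategoryTheory.Quotient.lift.isLift _ _ _

instance : NatTrans.CommShift F.toHCompMapH.hom ℤ :=
  CategoryTheory.Quotient.liftCommShift_compatibility (F.mapZ ⋙ toH C) (homologous B) _ _

/-- The third morphism s p goes to F(s) F(p), and the comparison s F(t) turns this into s F(p), the
standard third morphism for the image cone. -/
lemma mapZ_isConeTriangle {D : Triangle (ZCat B)} (hD : IsConeTriangle D) :
    IsConeTriangle (F.mapZ.mapTriangle.obj D) := by
  obtain ⟨u, p, q, h, hD⟩ := hD.exists_coneData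
  have h' := F.map_coneData h
  have : ConeData (F.mapZ.map D.mor₁).1 (F.mapZ.obj D.obj₃).as (F.mapZ.map D.mor₂).1
    (F.map u) (F.map p) (F.map q) := h'
  have e : F.mapZ.mapTriangle.obj D =
      Triangle.mk (F.mapZ.map D.mor₁) (F.mapZ.map D.mor₂) this.toShift := by
    refine congrArg (Triangle.mk (F.mapZ.map D.mor₁) (F.mapZ.map D.mor₂)) ?_
    refine ZCat.hom_ext_act (fun x => ?_)
    refine Eq.trans ?_ (this.act_toShift x).symm
    refine (ZCat.act_comp_val _ _ _).trans ?_
    refine (act_shiftIso_hom F 1 D.obj₁ _).trans ?_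
    refine congr(act (sElt (F.mapZ.obj D.obj₁) 1) $(?_))
    have hm : D.mor₃.1 = castDeg (by lia) (cmul (sElt D.obj₁ 1) p) := congr(($(hD).mor₃).1)
    have hm' (y : Elts (F.obj D.obj₃.as)) :
        act (F.map D.mor₃.1) y = act (F.map (sElt D.obj₁ 1)) (act (F.map p) y) := by
      rw [hm, map_castDeg, act_castDeg, map_cmul, act_cmul]
    exact congr(act (F.map (tElt D.obj₁ 1)) $(hm' x)).trans (act_map_tElt_sElt F D.obj₁ 1 _)
  rw [e]
  exact this.isConeTriangle

lemma mapH_mem_distTriangles {D : Triangle (HCat B)} (hD : D ∈ distTriangles B) :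
    F.mapH.mapTriangle.obj D ∈ distTriangles C := by
  obtain ⟨D', hD', ⟨e⟩⟩ := hD
  exact ⟨_, F.mapZ_isConeTriangle hD', ⟨F.mapH.mapTriangle.mapIso e ≪≫
    (Functor.mapTriangleCompIso (toH B) F.mapH).symm.app D' ≪≫
    (Functor.mapTriangleIso F.toHCompMapH).app D' ≪≫
    (Functor.mapTriangleCompIso F.mapZ (toH C)).app D'⟩⟩

lemma mapH_isTriangulated [PB : Pretriangulated (HCat B)] [PC : Pretriangulated (HCat C)]
    (hB : PB.distinguishedTriangles = distTriangles B)
    (hC : PC.distinguishedTriangles = distTriangles C) : F.mapH.IsTriangulated where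
  map_distinguished D hD := by
    rw [hB] at hD
    rw [hC]
    exact F.mapH_mem_distTriangles hD

end

end DGFunctor

/-! ### The full dg subcategory generated by a dg functor -/

section FullSubcategory

variable {C : Type u} [DGCategory.{v} C]

/-- The full dg subcategory of the objects that satisfy `P`. -/
structure FullSub (P : C → Prop) where
  obj : C
  property : P obj

variable (P : C → Prop)

instance : DGCategory.{v} (FullSub P) where
  Hom X Y k := Hom X.obj Y.obj k
  d i j h := d i j h
  comp h := comp h
  one X := one X.obj
  d_d i j k hij hjk φ := d_d i j k hij hjk φ
  d_one X := d_one X.obj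
  one_comp h φ := one_comp h φ
  comp_one h φ := comp_one h φ
  assoc hij hjk h h' φ ψ χ := assoc hij hjk h h' φ ψ χ
  leibniz hi hj hk h h₁ h₂ φ ψ := leibniz hi hj hk h h₁ h₂ φ ψ

/-- The inclusion of a full dg subcategory. -/
def FullSub.incl : DGFunctor (FullSub P) C where
  obj X := X.obj
  map := AddMonoidHom.id _
  map_d _ _ := rfl
  map_one _ := rfl
  map_comp _ _ _ := rfl

/-- A dg functor with values in a full dg subcategory. -/
def FullSub.lift {D : Type u'} [DGCategory.{v'} D] (F : DGFunctor D C) (hF : ∀ X, P (F.obj X)) :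
    DGFunctor D (FullSub P) where
  obj X := ⟨F.obj X, hF X⟩
  map := F.map
  map_d := F.map_d
  map_one := F.map_one
  map_comp := F.map_comp

variable {P}

lemma FullSub.isZeroObj {Z : FullSub P} (h : IsZeroObj Z.obj) : IsZeroObj Z :=
  fun X k => h X.obj k

lemma FullSub.isShift {X Y : FullSub P} {a : ℤ} {s : Hom X.obj Y.obj a}
    (h : IsShift X.obj a Y.obj s) : IsShift X a Y s where
  d_eq := h.d_eq
  bijective Z k l hl := h.bijective Z.obj k l hl

lemma FullSub.isCone {X Y Z : FullSub P} {f : Hom X.obj Y.obj 0} {i : Hom Y.obj Z.obj 0}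
    {u : Hom X.obj Z.obj 1} (h : IsCone f Z.obj i u) :
    IsCone (X := X) (Y := Y) f Z i u where
  d_inl := h.d_inl
  d_inr := h.d_inr
  bijective W k l hl := h.bijective W.obj k l hl

/-- A dg functor to a pretriangulated dg category, with values in the full dg subcategory of the
objects generated by its image. -/
def envelope {D : Type u'} [DGCategory.{v'} D] (F : DGFunctor D C) :
    DGFunctor D (FullSub (GeneratedBy F)) :=
  FullSub.lift _ F GeneratedBy.of

/-- A generation of Z in C takes place inside the subcategory: all intermediate objects are
themselves generated, and universal properties restrict to full subcategories. -/
lemma generatedBy_envelope {D : Type u'} [DGCategory.{v'} D] (F : DGFunctor D C)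
    (Z : FullSub (GeneratedBy F)) : GeneratedBy (envelope F) Z := by
  obtain ⟨Z, hZ⟩ := Z
  have h : ∀ {Z : C} (_ : GeneratedBy F Z) (hZ : GeneratedBy F Z),
      GeneratedBy (envelope F) ⟨Z, hZ⟩ := by
    intro Z h
    induction h with
    | of X => exact fun _ => GeneratedBy.of (ι := envelope F) X
    | zero Z h => exact fun _ => GeneratedBy.zero _ (FullSub.isZeroObj h)
    | shift a Y s hX hs ih =>
      exact fun hY => GeneratedBy.shift (X := ⟨_, hX⟩) a ⟨Y, hY⟩ s (ih hX) (FullSub.isShift hs)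
    | cone f Z i u hX hY hf h ihX ihY =>
      exact fun hZ => GeneratedBy.cone (X := ⟨_, hX⟩) (Y := ⟨_, hY⟩) f ⟨Z, hZ⟩ i u (ihX hX)
        (ihY hY) hf (FullSub.isCone h)
  exact h hZ hZ

instance {D : Type u'} [DGCategory.{v'} D] [IsPretriangulated C] (F : DGFunctor D C) :
    IsPretriangulated (FullSub (GeneratedBy F)) where
  exists_zero := by
    obtain ⟨Z, hZ⟩ := IsPretriangulated.exists_zero (B := C)
    exact ⟨⟨Z, .zero Z hZ⟩, FullSub.isZeroObj hZ⟩
  exists_shift X a := by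
    obtain ⟨Y, s, h⟩ := IsPretriangulated.exists_shift X.obj a
    exact ⟨⟨Y, .shift a Y s X.property h⟩, s, FullSub.isShift h⟩
  exists_cone {X Y} f hf := by
    obtain ⟨Z, i, u, h⟩ := IsPretriangulated.exists_cone (X := X.obj) (Y := Y.obj) f hf
    exact ⟨⟨Z, .cone (X := X.obj) (Y := Y.obj) f Z i u X.property Y.property hf h⟩, i, u,
      FullSub.isCone h⟩

lemma isPretriangulatedEnvelope_envelope {D : Type u'} [DGCategory.{v'} D] [IsPretriangulated C]
    (F : DGFunctor D C)
    (hF : ∀ (X Y : D) (k : ℤ), Function.Bijective (F.map (X := X) (Y := Y) (k := k))) :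
    IsPretriangulatedEnvelope (envelope F) where
  pretriangulated := inferInstance
  fullyFaithful := hF
  generated := generatedBy_envelope F

end FullSubcategory

/-! ### The dg category of strict ℤ[e]-modules in B -/

/-- The objects of `B` with an action of the exterior algebra `ℤ[e]`, `|e| = 1`, `d e = n`. -/
structure EMod (n : ℕ) (B : Type u) [DGCategory.{v} B] where
  as : B
  e : Hom as as 1
  e_e : comp (k := 2) (by lia) e e = 0
  d_e : d 1 0 (by lia) e = n • one as

namespace EMod

variable {n : ℕ} {B : Type u} [DGCategory.{v} B]

lemma act_e_e (M : EMod n B) (x : Elts M.as) : act M.e (act M.e x) = 0 := by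
  rw [act_act M.e_e, act_zero]

lemma eltD_act_e (M : EMod n B) (x : Elts M.as) :
    eltD _ (act M.e x) = n • x - act M.e (eltD _ x) := by
  have := act_d (j := 0) (by lia) M.e x
  rw [M.d_e, act_nsmul, act_one] at this
  rw [this]
  simp

/-- Constructor for objects with an action of `ℤ[e]`. -/
def mk' (X : B) (e : Hom X X 1) (h₁ : ∀ x, act e (act e x) = 0)
    (h₂ : ∀ x, eltD _ (act e x) = n • x - act e (eltD _ x)) : EMod n B where
  as := X
  e := e
  e_e := act_injective (fun x => by rw [act_comp, h₁, act_zero])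
  d_e := act_injective (fun x => by rw [act_d, h₂, act_nsmul, act_one]; simp)

/-- The morphisms of degree `k` that commute with the action of `e`, up to the sign `(-1)^k`. -/
def homs (M N : EMod n B) (k : ℤ) : AddSubgroup (Hom M.as N.as k) where
  carrier := {φ | ∀ x, act φ (act M.e x) = k.negOnePow • act N.e (act φ x)}
  zero_mem' x := by simp [act_zero]
  add_mem' {φ ψ} hφ hψ x := by rw [act_add, act_add, hφ, hψ, map_add, smul_add]
  neg_mem' {φ} hφ x := by rw [act_neg, act_neg, hφ, map_neg, smul_neg]

/-- Differentiating the commutation relation with e produces the extra terms n φ from de = n on both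
sides; they cancel because n is central. -/
lemma d_mem_homs {M N : EMod n B} {i j : ℤ} (h : j + 1 = i) {φ : Hom M.as N.as i}
    (hφ : φ ∈ homs M N i) : d i j h φ ∈ homs M N j := by
  intro x
  change ∀ x, _ at hφ
  subst h
  simp only [act_d, M.eltD_act_e, N.eltD_act_e, map_sub, hφ, map_units_smul_act, eltD_units_smul,
    map_nsmul]
  rcases Int.even_or_odd j with h | h
  · simp [Int.negOnePow_add, Int.negOnePow_even j h]
    abel
  · simp [Int.negOnePow_add, Int.negOnePow_odd j h]

lemma comp_mem_homs {M N K : EMod n B} {i j k : ℤ} (h : i + j = k) {φ : Hom N.as K.as i}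
    {ψ : Hom M.as N.as j} (hφ : φ ∈ homs N K i) (hψ : ψ ∈ homs M N j) :
    comp h φ ψ ∈ homs M K k := by
  intro x
  change ∀ x, _ at hφ hψ
  rw [act_comp, act_comp, hψ, map_units_smul_act, hφ, smul_smul, ← Int.negOnePow_add, add_comm, h]

lemma one_mem_homs (M : EMod n B) : one M.as ∈ homs M M 0 := by
  intro x
  simp [act_one]

instance : DGCategory.{v} (EMod n B) where
  Hom M N k := homs M N k
  d i j h := AddMonoidHom.mk' (fun φ => ⟨d i j h φ.1, d_mem_homs h φ.2⟩)
    (fun φ ψ => Subtype.ext (map_add (d i j h) φ.1 ψ.1))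
  comp h := AddMonoidHom.mk' (fun φ => AddMonoidHom.mk'
      (fun ψ => ⟨comp h φ.1 ψ.1, comp_mem_homs h φ.2 ψ.2⟩)
      (fun ψ ψ' => Subtype.ext (map_add (comp h φ.1) ψ.1 ψ'.1)))
    (fun φ φ' => by
      ext ψ
      exact congr($(map_add (comp h) φ.1 φ'.1) ψ.1))
  one M := ⟨one M.as, one_mem_homs M⟩
  d_d i j k hij hjk φ := Subtype.ext (d_d i j k hij hjk φ.1)
  d_one M := Subtype.ext (d_one M.as)
  one_comp h φ := Subtype.ext (one_comp h φ.1)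
  comp_one h φ := Subtype.ext (comp_one h φ.1)
  assoc hij hjk h h' φ ψ χ := Subtype.ext (assoc hij hjk h h' φ.1 ψ.1 χ.1)
  leibniz hi hj hk h h₁ h₂ φ ψ := Subtype.ext (leibniz hi hj hk h h₁ h₂ φ.1 ψ.1)

/-- The dg functor that forgets the action of `e`. -/
def forget : DGFunctor (EMod n B) B where
  obj M := M.as
  map {M N k} := (homs M N k).subtype
  map_d _ _ := rfl
  map_one _ := rfl
  map_comp _ _ _ := rfl

lemma act_act_e {M N : EMod n B} {k : ℤ} (φ : Hom M N k) (x : Elts M.as) :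
    act φ.1 (act M.e x) = k.negOnePow • act N.e (act φ.1 x) := φ.2 x

end EMod

/-! ### Zero objects, shifts and cones of modules -/

namespace EMod

variable {n : ℕ} {B : Type u} [DGCategory.{v} B]

/-- A morphism in `B` that commutes with the action of `e` up to sign, as a morphism of objects
with an action of `ℤ[e]`. -/
def homMk {M N : EMod n B} {k : ℤ} (φ : Hom M.as N.as k)
    (h : ∀ x, act φ (act M.e x) = k.negOnePow • act N.e (act φ x)) : Hom M N k := ⟨φ, h⟩

lemma exists_isZeroObj [IsPretriangulated B] : ∃ Z : EMod n B, IsZeroObj Z := by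
  obtain ⟨Z, hZ⟩ := IsPretriangulated.exists_zero (B := B)
  refine ⟨⟨Z, 0, (hZ Z _).1.elim _ _, (hZ Z _).1.elim _ _⟩, fun X k => ⟨?_, ?_⟩⟩
  · exact ⟨fun φ ψ => Subtype.ext ((hZ X.as k).1.elim _ _)⟩
  · exact ⟨fun φ ψ => Subtype.ext ((hZ X.as k).2.elim _ _)⟩

/-- The action is transported along the universal cycle s. The sign (-1)^a is the one that makes s,
of degree a, a morphism of modules. -/
lemma exists_isShift [IsPretriangulated B] (M : EMod n B) (a : ℤ) :
    ∃ (N : EMod n B) (s : Hom M N a), IsShift M a N s := by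
  obtain ⟨Y, s, hs⟩ := IsPretriangulated.exists_shift M.as a
  obtain ⟨s', hs', h₁, h₂⟩ := hs.exists_inverse (add_neg_cancel a)
  have ds := eltD_act hs.d_eq
  have ds' := eltD_act hs'
  rw [Int.negOnePow_neg] at ds'
  obtain ⟨e, he⟩ : ∃ e : Hom Y Y 1, ∀ y, act e y = a.negOnePow • act s (act M.e (act s' y)) :=
    ⟨a.negOnePow • castDeg (by lia) (cmul s (cmul M.e s')), fun y => by
      simp only [act_units_smul, act_castDeg, act_cmul]⟩
  have hs₁ (x : Elts M.as) : act s (act M.e x) = a.negOnePow • act e (act s x) := by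
    simp only [he, h₁, smul_smul, Int.units_mul_self, one_smul]
  have hs₂ (x : Elts Y) : act s' (act e x) = (-a).negOnePow • act M.e (act s' x) := by
    simp only [he, h₁, map_units_smul_act, Int.negOnePow_neg]
  refine ⟨mk' Y e (fun x => ?_) (fun x => ?_), homMk s hs₁,
    isShift_of_inverse (add_neg_cancel a) (s' := homMk s' hs₂) (Subtype.ext hs.d_eq)
    (Subtype.ext (act_injective (fun x => ?_))) (Subtype.ext (act_injective (fun x => ?_)))⟩
  · simp only [he, map_units_smul_act, h₁, M.act_e_e, map_zero, smul_zero]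
  · simp only [he, eltD_units_smul, ds, ds', h₂, M.eltD_act_e, map_sub, map_nsmul, smul_smul,
      Int.units_mul_self, one_smul, map_units_smul_act, smul_sub]
  · exact (act_comp _ _ _ _).trans ((h₁ x).trans (act_one _ _).symm)
  · exact (act_comp _ _ _ _).trans ((h₂ x).trans (act_one _ _).symm)

/-- The action on the cone is diagonal, i e q + u e p. In its differential the cross term i (f e - e
f) p vanishes as f is a module morphism, and n (i q - u p) = n remains. All of i, u, p and q are
module morphisms, so the cone equations of B hold for modules. -/
lemma exists_isCone [IsPretriangulated B] {M N : EMod n B} (f : Hom M N 0) (hf : IsClosed f) :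
    ∃ (C : EMod n B) (i : Hom N C 0) (u : Hom M C 1), IsCone f C i u := by
  replace hf : IsClosed f.1 := congr($(hf).1)
  obtain ⟨C, i, u, h⟩ := IsPretriangulated.exists_cone f.1 hf
  obtain ⟨p, q, h⟩ := h.exists_coneData
  have hfe (x) : act f.1 (act M.e x) = act N.e (act f.1 x) := by
    rw [act_act_e, Int.negOnePow_zero, one_smul]
  obtain ⟨e, he⟩ : ∃ e : Hom C C 1, ∀ y,
      act e y = act i (act N.e (act q y)) + act u (act M.e (act p y)) :=
    ⟨castDeg (by lia) (cmul i (cmul N.e q)) + castDeg (by lia) (cmul u (cmul M.e p)), fun y => by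
      simp only [act_add, act_castDeg, act_cmul]⟩
  have hi (x : Elts N.as) : act i (act N.e x) = (0 : ℤ).negOnePow • act e (act i x) := by
    simp [he, h.act_q_inl, h.act_p_inl]
  have hu (x : Elts M.as) : act u (act M.e x) = (1 : ℤ).negOnePow • act e (act u x) := by
    simp [he, h.act_q_inr, h.act_p_inr]
  have hp (x : Elts C) : act p (act e x) = (-1 : ℤ).negOnePow • act M.e (act p x) := by
    simp [he, h.act_p_inl, h.act_p_inr]
  have hq (x : Elts C) : act q (act e x) = (0 : ℤ).negOnePow • act N.e (act q x) := by
    simp [he, h.act_q_inl, h.act_q_inr]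
  refine ⟨mk' C e (fun x => ?_) (fun x => ?_), homMk i hi, homMk u hu, ConeData.isCone
    (p := homMk p hp) (q := homMk q hq)
    ⟨Subtype.ext h.d_inl, Subtype.ext h.d_inr, Subtype.ext h.p_inl, Subtype.ext h.p_inr,
      Subtype.ext h.q_inl, Subtype.ext h.q_inr, Subtype.ext h.total⟩⟩
  · simp only [he, map_add, h.act_q_inl, h.act_q_inr, h.act_p_inl,
      h.act_p_inr, M.act_e_e, N.act_e_e, map_zero, map_neg, neg_zero, add_zero]
  · simp only [he, map_add, map_sub, map_neg, map_nsmul, h.eltD_inl,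
      h.eltD_inr, h.eltD_p, h.eltD_q, M.eltD_act_e, N.eltD_act_e, hfe, h.act_inl_q, smul_add]
    abel

instance [IsPretriangulated B] : IsPretriangulated (EMod n B) where
  exists_zero := exists_isZeroObj
  exists_shift := exists_isShift
  exists_cone f hf := exists_isCone f hf

/-! ### Free modules and the embedding of ℤ[e] ⊗ B -/

section Free

variable (n)

lemma isClosed_nsmul_one (X : B) : IsClosed (n • one X) := by
  change d _ _ _ _ = 0
  rw [map_nsmul, d_one, smul_zero]

variable [IsPretriangulated B]

/-- A chosen mapping cone of multiplication by `n`. -/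
noncomputable def coneObj (X : B) : B :=
  (IsPretriangulated.exists_cone (n • one X) (isClosed_nsmul_one n X)).choose

/-- The morphism of degree `0` of the universal pair of the cone of multiplication by `n`. -/
noncomputable def coneInl (X : B) : Hom X (coneObj n X) 0 :=
  (IsPretriangulated.exists_cone (n • one X) (isClosed_nsmul_one n X)).choose_spec.choose

/-- The morphism of degree `1` of the universal pair of the cone of multiplication by `n`. -/
noncomputable def coneInr (X : B) : Hom X (coneObj n X) 1 :=
  (IsPretriangulated.exists_cone (n • one X)
    (isClosed_nsmul_one n X)).choose_spec.choose_spec.choose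

lemma isCone_coneObj (X : B) : IsCone (n • one X) (coneObj n X) (coneInl n X) (coneInr n X) :=
  (IsPretriangulated.exists_cone (n • one X)
    (isClosed_nsmul_one n X)).choose_spec.choose_spec.choose_spec

/-- The projection of degree `-1` of the cone of multiplication by `n`. -/
noncomputable def coneFst (X : B) : Hom (coneObj n X) X (-1) :=
  (isCone_coneObj n X).exists_coneData.choose

/-- The projection of degree `0` of the cone of multiplication by `n`. -/
noncomputable def coneSnd (X : B) : Hom (coneObj n X) X 0 :=
  (isCone_coneObj n X).exists_coneData.choose_spec.choose

lemma coneData (X : B) : ConeData (n • one X) (coneObj n X) (coneInl n X) (coneInr n X)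
    (coneFst n X) (coneSnd n X) :=
  (isCone_coneObj n X).exists_coneData.choose_spec.choose_spec

/-- The cone of multiplication by `n`, with its action of `ℤ[e]`. -/
noncomputable def free (X : B) : EMod n B :=
  -- Put e = u q, so that e i = u and e u = 0: the cone is ℤ[e] ⊗ X with i as the summand 1 and u as
  -- the summand e.
  mk' (coneObj n X) (castDeg (by lia) (cmul (coneInr n X) (coneSnd n X)))
    (fun x => by
      simp only [act_castDeg, act_cmul, (coneData n X).act_q_inr, map_zero])
    (fun x => by
      simp only [act_castDeg, act_cmul, (coneData n X).eltD_inr, (coneData n X).eltD_q,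
        act_nsmul, act_one, map_add, map_nsmul, (coneData n X).act_inl_q, smul_add]
      abel)

lemma act_free_e (X : B) (x : Elts (coneObj n X)) :
    act (free n X).e x = act (coneInr n X) (act (coneSnd n X) x) := by
  rw [← act_cmul, ← act_castDeg (j := 1) (by lia)]
  rfl

/-- The morphism `1 ⊗ φ + e ⊗ ψ` between free objects. -/
noncomputable def freeMap {X Y : B} {k l : ℤ} (h : l + 1 = k) (φ : Hom X Y k) (ψ : Hom X Y l) :
    Hom (coneObj n X) (coneObj n Y) k :=
  -- The map is prescribed on i as i φ + u ψ. Commuting with e forces the value (-1)^k u φ on u = e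
  -- i, and p u = -1 accounts for the minus sign of the last term.
  castDeg (by lia) (cmul (coneInl n Y) (cmul φ (coneSnd n X))) +
    castDeg (by lia) (cmul (coneInr n Y) (cmul ψ (coneSnd n X))) -
    k.negOnePow • castDeg (by lia) (cmul (coneInr n Y) (cmul φ (coneFst n X)))

lemma act_freeMap {X Y : B} {k l : ℤ} (h : l + 1 = k) (φ : Hom X Y k) (ψ : Hom X Y l)
    (x : Elts (coneObj n X)) : act (freeMap n h φ ψ) x =
      act (coneInl n Y) (act φ (act (coneSnd n X) x)) +
      act (coneInr n Y) (act ψ (act (coneSnd n X) x)) -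
      k.negOnePow • act (coneInr n Y) (act φ (act (coneFst n X) x)) := by
  simp only [freeMap, act_sub, act_add, act_units_smul, act_castDeg, act_cmul]

lemma freeMap_mem_homs {X Y : B} {k l : ℤ} (h : l + 1 = k) (φ : Hom X Y k) (ψ : Hom X Y l) :
    freeMap n h φ ψ ∈ homs (free n X) (free n Y) k := by
  have key (x : Elts (coneObj n X)) :
      act (freeMap n h φ ψ) (act (coneInr n X) (act (coneSnd n X) x)) =
        k.negOnePow • act (coneInr n Y) (act (coneSnd n Y) (act (freeMap n h φ ψ) x)) := by
    simp only [act_freeMap, (coneData n X).act_q_inr, (coneData n X).act_p_inr, map_zero, map_neg,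
      map_add, map_sub, map_units_smul_act, (coneData n Y).act_q_inl, (coneData n Y).act_q_inr,
      smul_neg, smul_zero, zero_add, add_zero, sub_neg_eq_add, sub_zero]
  intro x
  refine congr(act (freeMap n h φ ψ) $(act_free_e n X x)).trans ((key x).trans ?_)
  exact congr(k.negOnePow • $(act_free_e n Y _)).symm

lemma freeMap_add {X Y : B} {k l : ℤ} (h : l + 1 = k) (φ φ' : Hom X Y k) (ψ ψ' : Hom X Y l) :
    freeMap n h (φ + φ') (ψ + ψ') = freeMap n h φ ψ + freeMap n h φ' ψ' :=
  act_injective (fun x => by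
    simp only [act_freeMap, act_add, map_add, smul_add]
    abel)

lemma freeMap_one (X : B) (h : (-1 : ℤ) + 1 = 0) : freeMap n h (one X) 0 = one (coneObj n X) :=
  act_injective (fun x => by
    simp only [act_freeMap, act_one, act_zero, map_zero, (coneData n X).act_inl_q]
    simp)

/-- The summand n ψ comes from du = n i; the terms n i φ p arising from dq = n p and from du cancel.
-/
lemma d_freeMap {X Y : B} {k l l' m : ℤ} (h : l + 1 = k) (h' : l' + 1 = l)
    (hm : m + 1 = k) (hm' : l' + 1 = m) (hl : l = m) (φ : Hom X Y k) (ψ : Hom X Y l) :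
    d k m hm (freeMap n h φ ψ) = freeMap n hm' (d k m hm φ + n • castDeg hl ψ) (-d l l' h' ψ) :=
  act_injective (fun x => by
    subst hl h' hm
    simp only [act_freeMap, act_castDeg, act_add, act_neg, act_d, act_nsmul, map_add, map_sub,
      map_neg,
      map_nsmul, eltD_units_smul, map_units_smul_act, (coneData n X).eltD_p,
      (coneData n X).eltD_q, (coneData n Y).eltD_inl, (coneData n Y).eltD_inr, act_one]
    rcases Int.even_or_odd l' with h | h
    · simp [Int.negOnePow_add, Int.negOnePow_even l' h]
      abel
    · simp [Int.negOnePow_add, Int.negOnePow_odd l' h]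
      abel)

lemma freeMap_comp {X Y Z : B} {i i' j j' k k' : ℤ} (hi : i' + 1 = i) (hj : j' + 1 = j)
    (hk : k' + 1 = k) (h : i + j = k) (h₁ : i' + j = k') (h₂ : i + j' = k') (φ : Hom Y Z i)
    (ψ : Hom Y Z i') (φ' : Hom X Y j) (ψ' : Hom X Y j') :
    freeMap n hk (comp h φ φ') (comp h₁ ψ φ' + i.negOnePow • comp h₂ φ ψ') =
      comp h (freeMap n hi φ ψ) (freeMap n hj φ' ψ') :=
  act_injective (fun x => by
    subst h
    simp only [act_freeMap, act_comp, act_add, act_units_smul, map_add, map_sub,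
      map_units_smul_act, (coneData n Y).act_q_inl, (coneData n Y).act_q_inr,
      (coneData n Y).act_p_inl, (coneData n Y).act_p_inr, map_zero, map_neg,
      Int.negOnePow_add, add_zero, smul_zero, sub_zero]
    simp only [smul_neg, smul_smul, zero_sub, neg_neg, mul_comm j.negOnePow]
    abel)

/-- The dg functor from `ℤ[e] ⊗ B` that sends `X` to the cone of multiplication by `n` on `X`. -/
noncomputable def freeFunctor : DGFunctor (ZeTensor n B) (EMod n B) where
  obj X := free n X.as
  map {X Y k} := AddMonoidHom.mk' (fun x => ⟨freeMap n (sub_add_cancel k 1) x.1 x.2,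
    freeMap_mem_homs n _ _ _⟩) (fun x y => Subtype.ext
      (freeMap_add n (sub_add_cancel k 1) x.1 y.1 x.2 y.2))
  map_d {X Y i j} h x := Subtype.ext
    (d_freeMap n (sub_add_cancel i 1) _ h (sub_add_cancel j 1) _ x.1 x.2).symm
  map_one X := Subtype.ext (freeMap_one n X.as (by lia))
  map_comp {X Y Z i j k} h x y := Subtype.ext
    (freeMap_comp n (sub_add_cancel i 1) (sub_add_cancel j 1) (sub_add_cancel k 1) h _ _
      x.1 x.2 y.1 y.2)

lemma freeMap_injective {X Y : B} {k l : ℤ} (h : l + 1 = k) {φ φ' : Hom X Y k} {ψ ψ' : Hom X Y l}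
    (H : freeMap n h φ ψ = freeMap n h φ' ψ') : φ = φ' ∧ ψ = ψ' := by
  have h₁ (x : Elts X) := congr(act $H (act (coneInl n X) x))
  simp only [act_freeMap, (coneData n X).act_q_inl, (coneData n X).act_p_inl, map_zero, smul_zero,
    sub_zero] at h₁
  refine ⟨act_injective fun x => ?_, act_injective fun x => ?_⟩
  · have := congr(act (coneSnd n Y) $(h₁ x))
    simpa only [map_add, (coneData n Y).act_q_inl, (coneData n Y).act_q_inr, add_zero] using this
  · have := congr(act (coneFst n Y) $(h₁ x))
    simpa only [map_add, (coneData n Y).act_p_inl, (coneData n Y).act_p_inr, zero_add, neg_inj]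
      using this

/-- A module morphism out of a free module is determined by θ i, whose components are φ = q θ i and
ψ = -p θ i. -/
lemma freeMap_of_mem_homs {X Y : B} {k l : ℤ} (h : l + 1 = k)
    (θ : Hom (coneObj n X) (coneObj n Y) k)
    (hθ : θ ∈ homs (free n X) (free n Y) k) :
    freeMap n h (castDeg (by lia) (cmul (coneSnd n Y) (cmul θ (coneInl n X))))
      (-castDeg (by lia) (cmul (coneFst n Y) (cmul θ (coneInl n X)))) = θ :=
  act_injective (fun x => by
    have key (x : Elts (coneObj n X)) : act θ (act (coneInr n X) (act (coneSnd n X) x)) =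
        k.negOnePow • act (coneInr n Y) (act (coneSnd n Y) (act θ x)) :=
      (congr(act θ $(act_free_e n X x)).symm.trans (hθ x)).trans
        congr(k.negOnePow • $(act_free_e n Y _))
    -- As e i = u, linearity of θ expresses θ u p through θ i p. With θ i q = θ + θ u p, all of θ is
    -- then expressed through θ i.
    have h₁ := key (act (coneInl n X) (act (coneFst n X) x))
    have h₂ := (coneData n X).act_inl_q x
    have h₃ := (coneData n Y).act_inl_q (act θ (act (coneInl n X) (act (coneSnd n X) x)))
    simp only [(coneData n X).act_q_inl] at h₁
    have h₄ := congr(act θ $h₂)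
    rw [map_add, h₁] at h₄
    simp only [act_freeMap, act_neg, act_castDeg, act_cmul, map_neg]
    rw [h₃, eq_sub_of_add_eq h₄.symm]
    abel)

lemma freeFunctor_bijective (X Y : ZeTensor n B) (k : ℤ) :
    Function.Bijective ((freeFunctor n).map (X := X) (Y := Y) (k := k)) := by
  refine ⟨fun x y h => ?_, fun θ => ⟨(_, _), Subtype.ext
    (a1 := (freeFunctor n).map (_, _)) (a2 := θ)
    (freeMap_of_mem_homs n (sub_add_cancel k 1) θ.1 θ.2)⟩⟩
  obtain ⟨h₁, h₂⟩ := freeMap_injective n (sub_add_cancel k 1) congr(($h).1)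
  exact Prod.ext h₁ h₂

end Free

end EMod

/-! ### The reduction B/n and its adjunction -/

/-- An adjunction between functors on cycle categories induced by dg functors passes to the
homology categories. -/
noncomputable def DGFunctor.adjunctionMapH {B : Type u} [DGCategory.{v} B] {C : Type u'}
    [DGCategory.{v'} C] {F : DGFunctor B C} {G : DGFunctor C B} (adj : F.mapZ ⊣ G.mapZ) :
    F.mapH ⊣ G.mapH where
  unit :=
    { app X := (toH B).map (adj.unit.app X.as)
      naturality X Y f := by
        obtain ⟨f, rfl⟩ := (toH B).map_surjective (X := X.as) (Y := Y.as) f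
        exact (((toH B).map_comp _ _).symm.trans congr((toH B).map $(adj.unit.naturality f))).trans
          ((toH B).map_comp _ _) }
  counit :=
    { app X := (toH C).map (adj.counit.app X.as)
      naturality X Y f := by
        obtain ⟨f, rfl⟩ := (toH C).map_surjective (X := X.as) (Y := Y.as) f
        exact (((toH C).map_comp _ _).symm.trans
          congr((toH C).map $(adj.counit.naturality f))).trans ((toH C).map_comp _ _) }
  left_triangle_components X := (((toH C).map_comp _ _).symm.trans
    congr((toH C).map $(adj.left_triangle_components X.as))).trans ((toH C).map_id _)
  right_triangle_components X := (((toH B).map_comp _ _).symm.trans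
    congr((toH B).map $(adj.right_triangle_components X.as))).trans ((toH B).map_id _)

variable (n : ℕ) (B : Type u) [DGCategory.{v} B] [IsPretriangulated B]

/-- The full dg subcategory of `EMod n B` generated by the cones of multiplication by `n`. -/
abbrev Reduction : Type (max u v) := FullSub (GeneratedBy (EMod.freeFunctor n (B := B)))

namespace Reduction

/-- The dg functor `ℤ[e] ⊗ B ⟶ B/n`. -/
noncomputable abbrev ι : DGFunctor (ZeTensor n B) (Reduction n B) := envelope (EMod.freeFunctor n)

/-- The dg functor `B/n ⟶ B` that forgets the action of `ℤ[e]`. -/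
noncomputable abbrev t : DGFunctor (Reduction n B) B := (FullSub.incl _).comp EMod.forget

/-- The dg functor `B ⟶ B/n`. -/
noncomputable abbrev ρ : DGFunctor B (Reduction n B) := (ZeTensor.incl B n).comp (ι n B)

variable {B} in
lemma comp_freeMap_coneInl {X Y : B} {k l m : ℤ} (hl : l = m) (h : m + 1 = k) (φ : Hom X Y k)
    (ψ : Hom X Y l) : comp (add_zero k) (EMod.freeMap n h φ (castDeg hl ψ)) (EMod.coneInl n X) =
      comp (zero_add k) (EMod.coneInl n Y) φ + comp (by lia) (EMod.coneInr n Y) ψ :=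
  act_injective (fun x => by
    have hX := EMod.coneData n X
    simp only [act_add, act_comp, EMod.act_freeMap, hX.act_q_inl, hX.act_p_inl, map_zero, smul_zero,
      sub_zero, act_castDeg])

variable {B} in
lemma comp_freeMap_coneInr {X Y : B} {k m : ℤ} (h : m + 1 = k) (φ : Hom X Y k)
    (ψ : Hom X Y m) : k.negOnePow • comp rfl (EMod.freeMap n h φ ψ) (EMod.coneInr n X) =
      comp (by lia) (EMod.coneInr n Y) φ :=
  act_injective (fun x => by
    have hX := EMod.coneData n X
    simp only [act_units_smul, act_comp, EMod.act_freeMap, hX.act_q_inr, hX.act_p_inr, map_zero,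
      map_neg, add_zero, zero_sub, smul_neg, neg_neg, smul_smul, Int.units_mul_self, one_smul])

/-- The universal pairs of the cones of multiplication by `n`. -/
noncomputable def coneExtension : ConeExtension n (ι n B) (t n B) where
  η X := EMod.coneInl n X
  g X := EMod.coneInr n X
  isCone X := EMod.isCone_coneObj n X
  map_eta {X Y k l} h φ ψ := comp_freeMap_coneInl n (by lia) (by lia) φ ψ
  map_g {X Y k l} h φ ψ := comp_freeMap_coneInr n (by lia) φ (castDeg (by lia) ψ)

variable {n B}

lemma act_ρ_map {X Y : ZCat B} (f : X ⟶ Y) (x : Elts (EMod.coneObj n X.as)) :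
    act (X := EMod.coneObj n X.as) (Y := EMod.coneObj n Y.as) ((ρ n B).mapZ.map f).1.1 x =
      act (EMod.coneInl n Y.as) (act f.1 (act (EMod.coneSnd n X.as) x)) -
      act (EMod.coneInr n Y.as) (act f.1 (act (EMod.coneFst n X.as) x)) := by
  refine (EMod.act_freeMap n (sub_add_cancel 0 1) f.1 0 x).trans ?_
  simp [act_zero]

/-- The morphism from the cone of multiplication by `n` on `M` to `M`. -/
noncomputable def action (M : EMod n B) : Hom (EMod.coneObj n M.as) M.as 0 :=
  -- This is the multiplication ℤ[e] ⊗ M ⟶ M: it is 1 on i and, since p u = -1, it is e on u.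
  EMod.coneSnd n M.as - castDeg (by lia) (cmul M.e (EMod.coneFst n M.as))

lemma act_action (M : EMod n B) (x : Elts (EMod.coneObj n M.as)) : act (action M) x =
    act (EMod.coneSnd n M.as) x - act M.e (act (EMod.coneFst n M.as) x) := by
  simp only [action, act_sub, act_castDeg, act_cmul]

/-- Linearity of the multiplication amounts to e² = 0 on M. That it is closed, below, uses de = n,
which cancels dq = n p. -/
lemma action_mem_homs (M : EMod n B) : action M ∈ EMod.homs (EMod.free n M.as) M 0 := by
  have h := EMod.coneData n M.as
  have key (x : Elts (EMod.coneObj n M.as)) :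
      act (action M) (act (EMod.coneInr n M.as) (act (EMod.coneSnd n M.as) x)) =
        act M.e (act (action M) x) := by
    simp only [act_action, h.act_q_inr, h.act_p_inr, map_neg, map_sub, M.act_e_e]
    simp
  intro x
  refine congr(act (action M) $(EMod.act_free_e n M.as x)).trans ((key x).trans ?_)
  exact (one_smul ℤˣ _).symm

lemma isClosed_action (M : EMod n B) : IsClosed (action M) :=
  isClosed_of_eltD_act (fun x => by
    have h := EMod.coneData n M.as
    simp only [act_action, map_sub, h.eltD_q, h.eltD_p, M.eltD_act_e, act_nsmul, act_one, map_neg]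
    abel)

/-- The counit of the adjunction between `B` and `B/n` on cycle categories. -/
noncomputable def counit (M : ZCat (Reduction n B)) :
    (ρ n B).mapZ.obj ((t n B).mapZ.obj M) ⟶ M :=
  ⟨⟨action M.as.obj, action_mem_homs _⟩, Subtype.ext (isClosed_action M.as.obj)⟩

/-- The unit of the adjunction between `B` and `B/n` on cycle categories. -/
noncomputable def unit (X : ZCat B) : X ⟶ (t n B).mapZ.obj ((ρ n B).mapZ.obj X) :=
  ZCat.homMk (EMod.coneInl n X.as) (EMod.coneData n X.as).d_inl

variable (n B) in
/-- The adjunction between `B` and `B/n` on cycle categories. -/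
noncomputable def adjunctionZ : (ρ n B).mapZ ⊣ (t n B).mapZ where
  unit :=
    { app := unit
      naturality X Y f := ZCat.hom_ext_act (fun x => by
        have h := EMod.coneData n X.as
        refine (ZCat.act_comp_val _ _ _).trans (Eq.trans ?_ (ZCat.act_comp_val _ _ _).symm)
        refine Eq.trans ?_ (act_ρ_map f _).symm
        change act (EMod.coneInl n Y.as) (act f.1 x) =
          act (EMod.coneInl n Y.as) (act f.1 (act (EMod.coneSnd n X.as)
            (act (EMod.coneInl n X.as) x))) -
          act (EMod.coneInr n Y.as) (act f.1 (act (EMod.coneFst n X.as)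
            (act (EMod.coneInl n X.as) x)))
        rw [h.act_q_inl, h.act_p_inl, map_zero, map_zero, sub_zero]) }
  counit :=
    { app := counit
      naturality M N f := ZCat.hom_ext (Subtype.ext (act_injective (fun x => by
        have h := EMod.coneData n N.as.obj.as
        have key (x : Elts (EMod.coneObj n M.as.obj.as)) :
            act (action N.as.obj) (act (EMod.coneInl n N.as.obj.as) (act f.1.1
              (act (EMod.coneSnd n M.as.obj.as) x)) -
              act (EMod.coneInr n N.as.obj.as) (act f.1.1 (act (EMod.coneFst n M.as.obj.as) x))) =
            act f.1.1 (act (action M.as.obj) x) := by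
          simp only [act_action, map_sub, h.act_q_inl, h.act_p_inl, h.act_q_inr, h.act_p_inr,
            map_neg, EMod.act_act_e, Int.negOnePow_zero, one_smul, map_zero]
          abel
        refine (act_comp (B := B) _ _ _ x).trans (Eq.trans ?_ (act_comp (B := B) _ _ _ x).symm)
        exact congr(act (action N.as.obj) $(act_ρ_map ((t n B).mapZ.map f) x)).trans (key x)))) }
  left_triangle_components X := ZCat.hom_ext (Subtype.ext (act_injective (fun x => by
    have h := EMod.coneData n X.as
    have h' := EMod.coneData n (EMod.coneObj n X.as)
    have key (x : Elts (EMod.coneObj n X.as)) : act (action (EMod.free n X.as))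
        (act (EMod.coneInl n (EMod.coneObj n X.as)) (act (EMod.coneInl n X.as)
              (act (EMod.coneSnd n X.as) x)) -
              act (EMod.coneInr n (EMod.coneObj n X.as)) (act (EMod.coneInl n X.as)
              (act (EMod.coneFst n X.as) x))) = x := by
      -- On a free module e is u q, so the multiplication out of the double cone is written with the
      -- data of both cones.
      have key' (y : Elts (EMod.coneObj n (EMod.coneObj n X.as))) :
          act (X := EMod.coneObj n (EMod.coneObj n X.as)) (Y := EMod.coneObj n X.as)
            (action (EMod.free n X.as)) y =
          act (EMod.coneSnd n (EMod.coneObj n X.as)) y -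
            act (EMod.coneInr n X.as) (act (EMod.coneSnd n X.as)
              (act (EMod.coneFst n (EMod.coneObj n X.as)) y)) :=
        (act_action _ _).trans (congrArg (fun z : Elts (EMod.coneObj n X.as) =>
          act (EMod.coneSnd n (EMod.coneObj n X.as)) y - z) (EMod.act_free_e _ _ _))
      refine (key' _).trans ?_
      simp only [map_sub, h.act_q_inl, h'.act_q_inl, h'.act_p_inl, h'.act_q_inr, h'.act_p_inr,
        map_neg, map_zero, h.act_inl_q]
      abel
    refine (act_comp (B := B) _ _ _ x).trans (Eq.trans ?_ (act_one (B := B) _ x).symm)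
    exact congr(act (action (EMod.free n X.as)) $(act_ρ_map _ x)).trans (key x))))
  right_triangle_components M := ZCat.hom_ext_act (fun x => by
    have h := EMod.coneData n M.as.obj.as
    refine (ZCat.act_comp_val _ _ _).trans (Eq.trans ?_ (ZCat.act_id_val _ _).symm)
    have key (x : Elts M.as.obj.as) :
        act (action M.as.obj) (act (EMod.coneInl n M.as.obj.as) x) = x := by
      rw [act_action, h.act_q_inl, h.act_p_inl, map_zero, sub_zero]
    exact key x)

variable (n B)

/-- The mod-`n` reduction of the homology category of a pretriangulated dg category. -/
noncomputable def modReduction [PB : Pretriangulated (HCat B)]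
    [PE : Pretriangulated (HCat (Reduction n B))]
    (hB : PB.distinguishedTriangles = distTriangles B)
    (hE : PE.distinguishedTriangles = distTriangles (Reduction n B)) :
    ModReduction n (ρ n B).mapH (t n B).mapH where
  commShift := inferInstance
  exact := (ρ n B).mapH_isTriangulated hB hE
  adj := DGFunctor.adjunctionMapH (adjunctionZ n B)
  exists_triangle X := by
    -- The unit at X is the inclusion i of the chosen cone of n, so the required triangle is that
    -- cone's triangle.
    have h : ConeData (n • 𝟙 X.as : X.as ⟶ X.as).1 _ (unit X.as).1 _ _ _ := EMod.coneData n X.as.as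
    have e : (toH B).map (n • 𝟙 X.as) = n • 𝟙 X := by
      rw [Functor.map_nsmul, CategoryTheory.Functor.map_id]
      rfl
    have H : Triangle.mk (X := X) (Y := X) ((toH B).map (n • 𝟙 X.as)) ((toH B).map (unit X.as))
        ((toH B).mapTriangle.obj (Triangle.mk (n • 𝟙 X.as) (unit X.as) h.toShift)).mor₃ ∈
          PB.distinguishedTriangles := by
      rw [hB]
      exact h.mapTriangle_mem
    exact ⟨_, congrArg (fun f : X ⟶ X => Triangle.mk f ((toH B).map (unit X.as))
      ((toH B).mapTriangle.obj (Triangle.mk (n • 𝟙 X.as) (unit X.as) h.toShift)).mor₃) e ▸ H⟩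

end Reduction

end DGCategory

/-! ### Infinite order from a mod-n reduction -/

namespace ModReduction

variable {T : Type u} [Category.{v} T] [HasZeroObject T] [Preadditive T] [HasShift T ℤ]
  [∀ k : ℤ, (shiftFunctor T k).Additive] [Pretriangulated T] {n : ℕ}
  {S : Type u'} [Category.{v'} S] [HasZeroObject S] [Preadditive S]
  [HasShift S ℤ] [∀ k : ℤ, (shiftFunctor S k).Additive] [Pretriangulated S]
  {ρ : T ⥤ S} {ρr : S ⥤ T}

/-- Cones of the same morphism are isomorphic compatibly with the maps from K, so the unit may stand
for an arbitrary cone of n. -/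
lemma exists_iso (R : ModReduction n ρ ρr) {K Kn : T} {π : K ⟶ Kn} {δ : Kn ⟶ K⟦(1 : ℤ)⟧}
    (hK : Triangle.mk (n • 𝟙 K) π δ ∈ distTriang T) :
    ∃ e : Kn ≅ ρr.obj (ρ.obj K), π ≫ e.hom = R.adj.unit.app K := by
  obtain ⟨δ', hδ'⟩ := R.exists_triangle K
  have h : (n • 𝟙 K) ≫ 𝟙 K = 𝟙 K ≫ (n • 𝟙 K) := by rw [Category.comp_id, Category.id_comp]
  let E := isoTriangleOfIso₁₂ _ _ hK hδ' (Iso.refl K) (Iso.refl K) h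
  exact ⟨Triangle.π₃.mapIso E, E.hom.comm₂.trans (Category.id_comp _)⟩

/-- The essential image of ρr is stable under the step in the definition of the order: extensions
along the unit can be chosen in the image of ρr, and exactness puts their cones there too. -/
lemma orderGE (R : ModReduction n ρ ρr) (k : ℕ) {X : T} {Y : S} (e : X ≅ ρr.obj Y) :
    OrderGE n k X := by
  induction k generalizing X Y with
  | zero => trivial
  | succ k ih =>
    let := R.commShift
    have := R.exact
    let := R.adj.rightAdjointCommShift ℤ
    have : R.adj.CommShift ℤ := R.adj.commShift_of_leftAdjoint ℤ
    -- The right adjoint of an exact functor is exact, with the shift structure induced by the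
    -- adjunction.
    have : ρr.IsTriangulated := R.adj.isTriangulated_rightAdjoint
    intro K f Kn π δ hK
    obtain ⟨E, hE⟩ := R.exists_iso hK
    obtain ⟨f', hf'⟩ : ∃ f' : ρ.obj K ⟶ Y, R.adj.unit.app K ≫ ρr.map f' = f ≫ e.hom :=
      ⟨(R.adj.homEquiv _ _).symm (f ≫ e.hom),
        (R.adj.homEquiv_unit ..).symm.trans (Equiv.apply_symm_apply _ _)⟩
    -- The cone is taken in S, before applying ρr, so that the cone in T is of the form ρr C and the
    -- induction hypothesis applies.
    obtain ⟨C, a, b, hC⟩ := distinguished_cocone_triangle f'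
    let b' := ρr.map b ≫ (ρr.commShiftIso (1 : ℤ)).hom.app _
    have hC' : Triangle.mk (ρr.map f') (ρr.map a) b' ∈ distTriang T := ρr.map_distinguished _ hC
    have h₁ : (E.hom ≫ ρr.map f' ≫ e.inv) ≫ e.hom = E.hom ≫ ρr.map f' := by simp
    have h₂ : (e.hom ≫ ρr.map a) ≫ 𝟙 _ = e.hom ≫ ρr.map a := Category.comp_id _
    have h₃ : (b' ≫ E.inv⟦1⟧') ≫ E.hom⟦1⟧' = 𝟙 _ ≫ b' := by simp [← Functor.map_comp]
    refine ⟨E.hom ≫ ρr.map f' ≫ e.inv, by rw [reassoc_of% hE, reassoc_of% hf']; simp,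
      ρr.obj C, e.hom ≫ ρr.map a, b' ≫ E.inv⟦1⟧',
      isomorphic_distinguished _ hC' _ (Triangle.isoMk _ _ E e (Iso.refl _) h₁ h₂ h₃),
      ih (Iso.refl _)⟩

lemma nOrder_eq_top (R : ModReduction n ρ ρr) {X : T} {Y : S} (e : X ≅ ρr.obj Y) :
    nOrder n X = ⊤ := by
  refine ENat.eq_top_iff_forall_ge.2 (fun k => le_sSup ⟨k, rfl, R.orderGE k e⟩)

open ZeroObject in
lemma categoryNOrder_eq_top (R : ModReduction n ρ ρr) : categoryNOrder T n = ⊤ := by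
  have : ρr.IsRightAdjoint := ⟨_, ⟨R.adj⟩⟩
  refine R.nOrder_eq_top (Y := 0) ((isZero_zero T).iso ?_)
  refine (IsZero.iff_id_eq_zero _).2 ?_
  have := Functor.map_isZero ρr (isZero_zero S)
  exact this.eq_of_src _ _

end ModReduction

/-! ### Transport along an equivalence -/

section Equivalence

open DGCategory

variable {T : Type u} [Category.{v} T] [HasZeroObject T] [Preadditive T] [HasShift T ℤ]
  [∀ k : ℤ, (shiftFunctor T k).Additive] [Pretriangulated T]
  {U : Type w₁} [Category.{w₂} U] [HasZeroObject U] [Preadditive U] [HasShift U ℤ]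
  [∀ k : ℤ, (shiftFunctor U k).Additive] [Pretriangulated U] {n : ℕ}
  {S : Type u'} [Category.{v'} S] [HasZeroObject S] [Preadditive S]
  [HasShift S ℤ] [∀ k : ℤ, (shiftFunctor S k).Additive] [Pretriangulated S]
  {ρ : U ⥤ S} {ρr : S ⥤ U}

/-- Mod-`n` reductions can be transported along an equivalence of triangulated categories. -/
noncomputable def ModReduction.compEquivalence (R : ModReduction n ρ ρr) (F : T ⥤ U)
    [F.CommShift ℤ] [F.IsEquivalence]
    (hF : ∀ D : Triangle T, D ∈ distTriang T ↔ F.mapTriangle.obj D ∈ distTriang U) :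
    ModReduction n (F ⋙ ρ) (ρr ⋙ F.inv) where
  commShift := letI := R.commShift; inferInstance
  exact := by
    let := R.commShift
    have := R.exact
    have : F.IsTriangulated := ⟨fun D hD => (hF D).1 hD⟩
    infer_instance
  adj := F.asEquivalence.toAdjunction.comp R.adj
  exists_triangle X := by
    have : F.IsTriangulated := ⟨fun D hD => (hF D).1 hD⟩
    obtain ⟨δ, hδ⟩ := R.exists_triangle (F.obj X)
    let e : F.obj (F.inv.obj (ρr.obj (ρ.obj (F.obj X)))) ≅ _ := F.asEquivalence.counitIso.app _
    let δ' := F.preimage (e.hom ≫ δ ≫ (F.commShiftIso (1 : ℤ)).inv.app X)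
    let η := (F.asEquivalence.toAdjunction.comp R.adj).unit.app X
    have h₁ : F.map (n • 𝟙 X) ≫ 𝟙 _ = 𝟙 _ ≫ (n • 𝟙 (F.obj X)) := by
      rw [Functor.map_nsmul, CategoryTheory.Functor.map_id, Category.comp_id, Category.id_comp]
    -- The unit of the composite adjunction is the unit of the equivalence followed by the inverse
    -- applied to the unit of R. A triangle identity removes the equivalence.
    have h₂ : F.map η ≫ e.hom = 𝟙 _ ≫ R.adj.unit.app (F.obj X) := by
      have h {X : T} {Z : U} (E : T ≌ U) (g : E.functor.obj X ⟶ Z) :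
          E.functor.map (E.unit.app X ≫ E.inverse.map g) ≫ E.counit.app Z = g := by simp
      have hη : η = F.asEquivalence.unit.app X ≫ F.inv.map (R.adj.unit.app (F.obj X)) :=
        Adjunction.comp_unit_app F.asEquivalence.toAdjunction R.adj X
      rw [Category.id_comp, hη]
      exact h F.asEquivalence _
    have h₃ : (F.map δ' ≫ (F.commShiftIso (1 : ℤ)).hom.app X) ≫ (𝟙 (F.obj X))⟦1⟧' = e.hom ≫ δ := by
      simp [δ']
    exact ⟨δ', (hF _).2 (isomorphic_distinguished _ hδ _
      (Triangle.isoMk _ _ (Iso.refl _) (Iso.refl _) e h₁ h₂ h₃))⟩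

end Equivalence

/-! ### The main theorem -/

theorem mainTheorem2 {T : Type u} [Category.{v} T] [HasZeroObject T] [Preadditive T]
    [HasShift T ℤ] [∀ k : ℤ, (shiftFunctor T k).Additive] [Pretriangulated T] [IsTriangulated T]
    (n : ℕ) (hn : 1 ≤ n) (hT : IsAlgebraicTriangulated.{v', u'} T) :
    HasModReduction.{v', max u' v'} T n ∧ categoryNOrder T n = ⊤ ∧
    ∀ (B : Type u') [DGCategory.{v'} B] [DGCategory.IsPretriangulated B],
      ∃ (PB : Pretriangulated (DGCategory.HCat B)) (_ : IsTriangulated (DGCategory.HCat B))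
        (_ : PB.distinguishedTriangles = DGCategory.distTriangles B)
        (E : Type (max u' v')) (_ : DGCategory.{v'} E) (_ : DGCategory.IsPretriangulated E)
        (PE : Pretriangulated (DGCategory.HCat E)) (_ : IsTriangulated (DGCategory.HCat E))
        (_ : PE.distinguishedTriangles = DGCategory.distTriangles E)
        (ι : DGCategory.DGFunctor (DGCategory.ZeTensor n B) E)
        (t : DGCategory.DGFunctor E B)
        (c : DGCategory.ConeExtension n ι t)
        (R : ModReduction n ((DGCategory.ZeTensor.incl B n).comp ι).mapH t.mapH),
        DGCategory.IsPretriangulatedEnvelope ι ∧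
        ∀ X : B, R.adj.unit.app (DGCategory.HCat.of X) =
          DGCategory.HCat.homMk (c.η X) (c.isCone X).d_inl := by
  -- The reduction of H(B) is pulled back to T along the equivalence; it also serves for the
  -- statement on the order.
  have key : ∃ (S : Type (max u' v')) (_ : Category.{v'} S) (_ : HasZeroObject S)
      (_ : Preadditive S) (_ : HasShift S ℤ) (_ : ∀ k : ℤ, (shiftFunctor S k).Additive)
      (_ : Pretriangulated S) (_ : IsTriangulated S) (ρ : T ⥤ S) (ρr : S ⥤ T),
      Nonempty (ModReduction n ρ ρr) := by
    obtain ⟨B, _, _, F, _, _, hF⟩ := hT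
    let := DGCategory.pretriangulatedHCat B
    let := DGCategory.pretriangulatedHCat (DGCategory.Reduction n B)
    exact ⟨DGCategory.HCat (DGCategory.Reduction n B), inferInstance,
      inferInstance, inferInstance, inferInstance,
      inferInstance, inferInstance, DGCategory.isTriangulated_hCat _, _, _,
      ⟨(DGCategory.Reduction.modReduction n B rfl rfl).compEquivalence F hF⟩⟩
  refine ⟨key, ?_, fun B _ _ => ?_⟩
  · obtain ⟨S, _, _, _, _, _, _, _, ρ, ρr, ⟨R⟩⟩ := key
    exact R.categoryNOrder_eq_top
  · let := DGCategory.pretriangulatedHCat B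
    let := DGCategory.pretriangulatedHCat (DGCategory.Reduction n B)
    exact ⟨inferInstance, DGCategory.isTriangulated_hCat _, rfl,
      DGCategory.Reduction n B, inferInstance, inferInstance,
      inferInstance, DGCategory.isTriangulated_hCat _, rfl,
      DGCategory.Reduction.ι n B, DGCategory.Reduction.t n B,
      DGCategory.Reduction.coneExtension n B, DGCategory.Reduction.modReduction n B rfl rfl,
      DGCategory.isPretriangulatedEnvelope_envelope _ (DGCategory.EMod.freeFunctor_bijective n),
      fun X => rfl⟩
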